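/- Let $T$ be a complete first-order theory in a language $L$ without function symbols or individual constants, let $P$ be a monadic predicate of $L$, and put $|T|=\max(\aleph_0,|L|)$. Assume that $T$ eliminates quantifiers down to predicates: every $L$-formula in $n\ge 1$ free variables is equivalent modulo $T$ to an $n$-place predicate of $L$. Let $\mathcal C$ be a monster model of $T$, that is, a $\kappa$-saturated and strongly $\kappa$-homogeneous model of $T$, where $\kappa$ is so large that $|T|<\mu<\kappa$ for some cardinal $\mu$ with $\mu=\mu^{<\mu}$. "Set" means a subset of $\mathcal C$ of size $<\kappa$, "model" means an elementary submodel of $\mathcal C$ of size $<\kappa$, and tuples are finite. Assume (Hypothesis 1): (1) every relation on $P^{\mathcal C}$ that is definable without parameters in $\mathcal C$ is definable without parameters in the induced structure $\mathcal C|P^{\mathcal C}$; (2) for every tuple $\bar c$ of $\mathcal C$ and every $L$-formula $\psi(\bar x,\bar y)$ there are an $L$-formula $\theta(\bar y,\bar z)$ and a tuple $\bar d\subseteq P^{\mathcal C}$ such that $\models\psi(\bar c,\bar a)\Leftrightarrow\ \models\theta(\bar a,\bar d)$ for all $\bar a\subseteq P^{\mathcal C}$. Definitions. A subset $A$ of $\mathcal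 C$ is *complete* if for every $L$-formula $\psi(\bar x,\bar y)$ and $\bar b\subseteq A$, whenever $\psi(\bar x,\bar b)$ has a solution in $P^{\mathcal C}$ it has a solution in $P^{\mathcal C}\cap A$. For sets $A,B$ write $A\equiv B$ if the induced $L$-structures $\mathcal C|A$ and $\mathcal C|B$ have the same complete theory. Let $$S_*(A)=\{\operatorname{tp}(\bar c/A) : \bar c\subseteq\mathcal C \text{ a tuple},\ P^{\mathcal C}\cap(A\cup\bar c)=P^{\mathcal C}\cap A,\ A\cup\bar c \text{ complete}\}.$$ A set $A$ is *stable* if it is complete and $|S_*(A')|\le|A'|^{|T|}$ for every set $A'\equiv A$. Assume (Hypothesis 2): every model is a stable set. Theorem. Let $A$ be a stable set with $|A|\ge 2$. Then for every $L$-formula $\psi(\bar x,\bar y)$ there is a quantifier-free $L$-formula $\Psi_\psi(\bar y,\bar z)$ such that for every set $B\equiv A$ and every $p\in S_*(B)$ in the variables $\bar x$ there is a tuple $\bar d\subseteq B$ such that, for all $\bar a\subseteq B$, $$\psi(\bar x,\bar a)\in p\iff \mathcal C|B\models\Psi_\psi(\bar a,\bar d).$$ -/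

import Mathlib

universe u

namespace StableOverP

open FirstOrder FirstOrder.Language
open scoped Cardinal

/-- Every formula in at least one free variable is equivalent modulo `T` to a predicate of the
language. (For sentences nothing has to be required: they are decided by a complete theory.) -/
def EliminatesToPredicates {L : FirstOrder.Language.{u, u}} (T : L.Theory) : Prop :=
  ∀ (n : ℕ) (φ : L.Formula (Fin (n + 1))), ∃ R : L.Relations (n + 1),
    φ ⇔[T] R.formula (fun i => Term.var i)

/-- The cardinal `|T|` of a theory in the language `L`: the number of formulas of `L`, that is
the maximum of `ℵ₀` and of the number of symbols. -/
noncomputable def theoryCard (L : FirstOrder.Language.{u, u}) : Cardinal.{u} :=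
  max ℵ₀ L.card

/-- `C` is a monster model of `T` for sets of size less than `κ`: a model of `T` that is
`κ`-saturated and strongly `κ`-homogeneous. -/
structure IsMonster {L : FirstOrder.Language.{u, u}} (κ : Cardinal.{u}) (T : L.Theory) (C : Type u)
    [L.Structure C] [Nonempty C] : Prop where
  /-- `C` is a model of `T`. -/
  models : C ⊨ T
  /-- Every complete type in finitely many variables over a small set is realized. -/
  saturated : ∀ A : Set C, #A < κ →
    ∀ (n : ℕ) (p : ((L[[A]]).completeTheory C).CompleteType (Fin n)),
      ∃ c : Fin n → C, ((L[[A]]).completeTheory C).typeOf c = p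
  /-- Every elementary map defined on a small set extends to an automorphism. -/
  homogeneous : ∀ (A : Set C) (f : A → C), #A < κ →
    (∀ (n : ℕ) (φ : L.Formula (Fin n)) (a : Fin n → A),
      φ.Realize (fun i => (a i : C)) ↔ φ.Realize (fun i => f (a i))) →
    ∃ σ : C ≃[L] C, ∀ a : A, σ a = f a

section

variable {L : FirstOrder.Language.{u, u}} {C : Type u} [L.Structure C]

/-- The structure `C|A` induced on a subset `A`. The language has no function symbols, so every
subset is the universe of a substructure. -/
def induced [L.IsRelational] (A : Set C) : L.Substructure C where
  carrier := A
  fun_mem := fun f => isEmptyElim f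

/-- `A ≡ B`, that is, `Th(C|A) = Th(C|B)`. -/
def SetEquiv (L : FirstOrder.Language.{u, u}) {C : Type u} [L.Structure C] [L.IsRelational]
    (A B : Set C) : Prop :=
  (induced A : L.Substructure C) ≅[L] (induced B : L.Substructure C)

/-- The set `P^C` of the elements of `C` that satisfy the monadic predicate `P`. -/
def PPart (C : Type u) [L.Structure C] (P : L.Relations 1) : Set C :=
  {x | Structure.RelMap P ![x]}

/-- Each relation on `P^C` that is definable in `C` without parameters is definable without
parameters in the induced structure `C|P^C`. -/
def DefinableInP (C : Type u) [L.Structure C] [L.IsRelational] (P : L.Relations 1) : Prop :=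
  ∀ (n : ℕ) (s : Set (Fin n → C)), (∀ x ∈ s, ∀ i, x i ∈ PPart C P) →
    (∅ : Set C).Definable L s →
    (∅ : Set (induced (PPart C P) : L.Substructure C)).Definable L
      {x : Fin n → (induced (PPart C P) : L.Substructure C) | (fun i => (x i : C)) ∈ s}

/-- Every type `tp_ψ(c/P^C)`, for `c` a finite tuple of `C`, is definable over `P^C`. -/
def TypesOverPDefinable (C : Type u) [L.Structure C] (P : L.Relations 1) : Prop :=
  ∀ (n m : ℕ) (ψ : L.Formula (Fin n ⊕ Fin m)) (c : Fin n → C),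
    ∃ (k : ℕ) (θ : L.Formula (Fin m ⊕ Fin k)) (d : Fin k → PPart C P),
      ∀ a : Fin m → PPart C P,
        ψ.Realize (Sum.elim c fun i => (a i : C)) ↔
          θ.Realize (Sum.elim (fun i => (a i : C)) fun i => (d i : C))

/-- `A` is complete: for all formulas `ψ(x, y)` and tuples `b` of `A`, if `ψ(x, b)` has a solution
in `P^C`, then it has one in `P^C ∩ A`. -/
def IsCompleteSet (P : L.Relations 1) (A : Set C) : Prop :=
  ∀ (n m : ℕ) (ψ : L.Formula (Fin n ⊕ Fin m)) (b : Fin m → A),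
    (∃ x : Fin n → C, (∀ i, x i ∈ PPart C P) ∧ ψ.Realize (Sum.elim x fun i => (b i : C))) →
    ∃ a : Fin n → C, (∀ i, a i ∈ PPart C P ∩ A) ∧ ψ.Realize (Sum.elim a fun i => (b i : C))

/-- The types over `A` in the variables `x₀, …, xₙ₋₁`. -/
abbrev TypeOver (L : FirstOrder.Language.{u, u}) {C : Type u} [L.Structure C] (A : Set C) (n : ℕ) : Type u :=
  ((L[[A]]).completeTheory C).CompleteType (Fin n)

/-- The type `tp(c/A)`. -/
noncomputable def tp [Nonempty C] (A : Set C) {n : ℕ} (c : Fin n → C) : TypeOver L A n :=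
  ((L[[A]]).completeTheory C).typeOf c

/-- The types in `S_*(A)` in `n` variables: the types `tp(c/A)` such that
`P ∩ (A ∪ c) = P ∩ A` and `A ∪ c` is complete. -/
def StarTypes [Nonempty C] (P : L.Relations 1) (A : Set C) (n : ℕ) : Set (TypeOver L A n) :=
  {p | ∃ c : Fin n → C, tp A c = p ∧
    PPart C P ∩ (A ∪ Set.range c) = PPart C P ∩ A ∧ IsCompleteSet P (A ∪ Set.range c)}

/-- `A` is stable: it is complete, and `|S_*(A')| ≤ |A'| ^ |T|` for all (small) `A' ≡ A`. -/
def IsStableSet [L.IsRelational] [Nonempty C] (κ : Cardinal.{u}) (P : L.Relations 1)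
    (A : Set C) : Prop :=
  IsCompleteSet P A ∧ ∀ A' : Set C, #A' < κ → SetEquiv L A' A →
    #(Σ n : ℕ, StarTypes P A' n) ≤ #A' ^ theoryCard L

/-- The formula `ψ(x, a)` with parameters from `A`, for a formula `ψ(x, y)` and a tuple `a`
of `A`. -/
def instParams {A : Set C} {n m : ℕ} (ψ : L.Formula (Fin n ⊕ Fin m)) (a : Fin m → A) :
    (L[[A]]).Formula (Fin n) :=
  ((L.lhomWithConstants A).onFormula ψ).subst
    (Sum.elim Term.var fun j => (L.con (a j)).term)

/-- `ψ(x, a)` belongs to the type `p`. -/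
def MemType {A : Set C} {n m : ℕ} (ψ : L.Formula (Fin n ⊕ Fin m)) (a : Fin m → A)
    (p : TypeOver L A n) : Prop :=
  Formula.equivSentence (instParams ψ a) ∈ p

theorem realize_instParams {A : Set C} {n m : ℕ} (ψ : L.Formula (Fin n ⊕ Fin m))
    (a : Fin m → A) (c : Fin n → C) :
    (instParams ψ a).Realize c ↔ ψ.Realize (Sum.elim c fun i => (a i : C)) := by
  unfold instParams
  rw [Formula.Realize, BoundedFormula.realize_subst]
  have h : (fun i => ((Sum.elim Term.var fun j => (L.con (a j)).term :
      Fin n ⊕ Fin m → (L[[A]]).Term (Fin n)) i).realize c) =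
      Sum.elim c fun i => (a i : C) := by
    funext i
    rcases i with i | i <;> simp
  rw [h]
  exact LHom.realize_onBoundedFormula _ ψ

theorem memType_tp [Nonempty C] {A : Set C} {n m : ℕ} (ψ : L.Formula (Fin n ⊕ Fin m))
    (a : Fin m → A) (c : Fin n → C) :
    MemType ψ a (tp A c) ↔ ψ.Realize (Sum.elim c fun i => (a i : C)) := by
  unfold MemType tp
  rw [Theory.CompleteType.formula_mem_typeOf, realize_instParams]

/-- `Ψ(y, d)` defines `p|ψ` over `A`: for all tuples `a` of `A`, the formula `ψ(x, a)` belongs to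
`p` if and only if the induced structure on `A` satisfies `Ψ(a, d)`. -/
def DefinesRestriction [L.IsRelational] {A : Set C} {n m k : ℕ} (p : TypeOver L A n)
    (ψ : L.Formula (Fin n ⊕ Fin m)) (Ψ : L.Formula (Fin m ⊕ Fin k))
    (d : Fin k → (induced A : L.Substructure C)) : Prop :=
  ∀ a : Fin m → (induced A : L.Substructure C),
    MemType ψ (A := A) a p ↔ Ψ.Realize (Sum.elim a d)

end

end StableOverP

/-! Fix `μ` with `|T| < μ < κ` and `μ^{<μ} = μ`, so that `μ^{|T|} = μ`. If `|B| ≤ μ` and the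
stability bound holds for `B`, then `S_*(B)` has at most `μ` members, so there is no binary tree of
height `μ` whose `2^μ` branches determine distinct types in `S_*(B)`. A branch determines such a
type if it is consistent and, for each `B`-definable relation `Y(x, z)`, either forbids solutions
`z` in `P` or names one in `P ∩ B`. The impossibility of this tree (`false_of_splitting`) is how
stability is used, and it is used twice.

Over a saturated model it bounds a rank (`exists_rank_bound`): rank `k + 1` asks for a splitting by
`ψ` into two parts of rank `k`, and for witnesses in `P` that keep rank `k`, for finitely many
formulas. If all these ranks were infinite, compactness would build the tree.

Over a set `B` that is itself sufficiently saturated it gives density of isolated types: a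
consistent family of fewer than `μ` sets definable over `B` remains consistent with some set that
decides every instance of `ψ` over `B` (`IsStableBase.exists_decides`). Hence a tuple `e` isolated
over `B` extends to an isolated tuple in any definable set that contains some extension of `e`
(`IsStableBase.extend_isolated`).

For one type `tp(c/B)` in `S_*(B)` one descends on the rank of a set `q(e, x)` that contains `c`,
with `e` isolated over `B` (`IsStableBase.exists_definition`). Suppose no instance over `B` lowers
the rank on the side of `c`. If no instance of `ψ` at all splits `q(e, x)` into two parts of large
rank, then `ψ(c, a)` holds exactly when `q(e, x) ∧ ψ(x, a)` has large rank; this is a definable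
condition on `(e, a)`, and isolation of `e` turns it into a formula over `B`. Otherwise the rank is
bounded because of a witness requirement. Its parameters can be taken isolated together with `e`,
and either `c` has no witness or it gets one in `P ∩ B`; both lower the rank.

Uniformity is compactness. If no formula serves all `(B, c)`, then, since finitely many formulas can
be coded into one over a set with two elements (`exists_code`), some saturated pair `(N, Q)` of size
at most `μ` defeats all formulas at once. It embeds into `C`, where the image of `Q` is elementarily
equivalent to `A` and contradicts the case of one type. Elimination down to predicates makes the
definition quantifier-free. -/

namespace StableOverP

open FirstOrder FirstOrder.Language Set
open scoped Cardinal

/-! ### Formulas in arbitrarily many variables -/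

section Formulas

variable {L : FirstOrder.Language.{u, u}}

theorem exists_fin_formula {α : Type u} (φ : L.Formula α) :
    ∃ (k : ℕ) (ψ : L.Formula (Fin k)) (t : Fin k → α),
      ∀ (M : Type u) [L.Structure M] (v : α → M), φ.Realize v ↔ ψ.Realize (v ∘ t) := by
  classical
  let e := Fintype.equivFin φ.freeVarFinset
  refine ⟨_, Formula.relabel e (BoundedFormula.restrictFreeVar φ id : L.Formula φ.freeVarFinset),
    fun i => (e.symm i : α), fun M _ v => ?_⟩
  rw [Formula.realize_relabel]
  refine (BoundedFormula.realize_restrictFreeVar (φ := φ) (f := id) v ?_).symm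
  intro a
  simp

theorem realize_congr_freeVar {α : Type u} [DecidableEq α] (φ : L.Formula α) {M : Type u}
    [L.Structure M] {v w : α → M} (h : ∀ a ∈ φ.freeVarFinset, v a = w a) :
    φ.Realize v ↔ φ.Realize w := by
  unfold Formula.Realize
  rw [← BoundedFormula.realize_restrictFreeVar (φ := φ) (f := id)
      (v := fun a : φ.freeVarFinset => w a) v fun a => (h a a.2).symm,
    ← BoundedFormula.realize_restrictFreeVar (φ := φ) (f := id)
      (v := fun a : φ.freeVarFinset => w a) w fun a => rfl]

/-- Finitely many formulas that are jointly satisfied in a structure are jointly satisfied in every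
elementarily equivalent structure. -/
theorem exists_realize_of_elementarilyEquivalent {M N : Type u} [L.Structure M] [L.Structure N]
    [Nonempty M] [Nonempty N] (h : M ≅[L] N) {α : Type*} (s : Finset (L.Formula α)) (v : α → M)
    (hv : ∀ φ ∈ s, φ.Realize v) : ∃ w : α → N, ∀ φ ∈ s, φ.Realize w := by
  classical
  let χ : L.Formula α := Formula.iInf fun φ : s => (φ : L.Formula α)
  have h1 : M ⊨ χ.exClosure := by
    rw [← Formula.exists_realize_equivSentence_iff_realize_exClosure]
    refine ⟨v, ?_⟩
    let _ := constantsOn.structure v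
    rw [Formula.realize_equivSentence]
    exact Formula.realize_iInf.2 fun φ => hv φ φ.2
  rw [elementarilyEquivalent_iff.1 h,
    ← Formula.exists_realize_equivSentence_iff_realize_exClosure] at h1
  obtain ⟨w, hw⟩ := h1
  refine ⟨w, fun φ hφ => ?_⟩
  let _ := constantsOn.structure w
  rw [Formula.realize_equivSentence] at hw
  exact Formula.realize_iInf.1 hw ⟨φ, hφ⟩

/-- Compactness: a finitely satisfiable set of formulas over a structure is contained in a complete
type. -/
theorem exists_completeType {N : Type u} [L.Structure N] [Nonempty N] {α : Type*}
    (Γ : Set (L.Formula α))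
    (hΓ : ∀ s : Finset (L.Formula α), ↑s ⊆ Γ → ∃ w : α → N, ∀ φ ∈ s, φ.Realize w) :
    ∃ p : (L.completeTheory N).CompleteType α, ∀ φ ∈ Γ, Formula.equivSentence φ ∈ p := by
  classical
  have h : ((L.lhomWithConstants α).onTheory (L.completeTheory N) ∪
      Formula.equivSentence '' Γ).IsSatisfiable := by
    rw [Theory.isSatisfiable_iff_isFinitelySatisfiable]
    intro T₀ hT₀
    obtain ⟨w, hw⟩ := hΓ ((T₀.image Formula.equivSentence.symm).filter (· ∈ Γ))
      (by intro φ hφ; simpa using (Finset.mem_filter.1 (Finset.mem_coe.1 hφ)).2)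
    let _ := constantsOn.structure w
    have : N ⊨ (T₀ : L[[α]].Theory) := by
      refine ⟨fun φ hφ => ?_⟩
      rcases hT₀ hφ with h1 | ⟨ψ, hψ, rfl⟩
      · have : N ⊨ (L.lhomWithConstants α).onTheory (L.completeTheory N) :=
          (LHom.onTheory_model _ _).2 inferInstance
        exact this.realize_of_mem _ h1
      · rw [Formula.realize_equivSentence]
        refine hw ψ ?_
        rw [Finset.mem_filter]
        exact ⟨Finset.mem_image.2 ⟨_, hφ, by simp⟩, hψ⟩
    exact Theory.Model.isSatisfiable N
  by_contra hp
  push Not at hp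
  refine (Theory.CompleteType.setOfPred_subset_eq_empty_iff _).1 ?_ h
  ext p
  simp only [mem_ofPred_eq, mem_empty_iff_false, iff_false]
  intro h2
  obtain ⟨φ, hφ, h3⟩ := hp p
  exact h3 (h2 ⟨φ, hφ, rfl⟩)

theorem exists_model_realizing {N : Type u} [L.Structure N] [Nonempty N] {α : Type u}
    (Γ : Set (L.Formula α))
    (hΓ : ∀ s : Finset (L.Formula α), ↑s ⊆ Γ → ∃ w : α → N, ∀ φ ∈ s, φ.Realize w) :
    ∃ (M : Type u) (_ : L.Structure M) (_ : Nonempty M), (M ≅[L] N) ∧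
      ∃ v : α → M, ∀ φ ∈ Γ, φ.Realize v := by
  obtain ⟨p, hp⟩ := exists_completeType Γ hΓ
  obtain ⟨M, v, hv⟩ := Theory.exists_modelType_is_realized_in _ p
  refine ⟨M, inferInstance, inferInstance, ?_, v, fun φ hφ => ?_⟩
  · exact (completeTheory.isComplete L N).models_elementarily_equivalent M N
  · have := hp φ hφ
    rwa [← hv, Theory.CompleteType.formula_mem_typeOf] at this

end Formulas

/-! ### Transfinite constructions of length a regular cardinal -/

section Stages

variable {I : Type u} [LinearOrder I] [WellFoundedLT I] {X : Type u}

/-- The union of the sets added before stage `i`, when `ext j r` is what is added at stage `j` to the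
set `r` reached so far. -/
def stages (ext : I → Set X → Set X) : I → Set X :=
  wellFounded_lt.fix fun i U => ⋃ j : Iio i, ext j (U j j.2)

theorem stages_eq (ext : I → Set X → Set X) (i : I) :
    stages ext i = ⋃ j : Iio i, ext j (stages ext j) :=
  wellFounded_lt.fix_eq _ i

theorem mem_stages {ext : I → Set X → Set X} {i : I} {x : X} :
    x ∈ stages ext i ↔ ∃ j < i, x ∈ ext j (stages ext j) := by
  rw [stages_eq]; simp

theorem stages_congr {ext ext' : I → Set X → Set X} (i : I) (h : ∀ j < i, ext j = ext' j) :
    stages ext i = stages ext' i := by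
  induction i using WellFoundedLT.induction with
  | ind i ih =>
    ext x
    rw [mem_stages, mem_stages]
    refine exists_congr fun j => and_congr_right fun hj => ?_
    rw [ih j hj fun k hk => h k (hk.trans hj), h j hj]

/-- The element of `s` that enters last determines the stage, because `s` is finite. -/
theorem exists_stage_of_finset {ext : I → Set X → Set X} {s : Finset X} (hs : s.Nonempty)
    {D : Set I} (h : ∀ x ∈ s, ∃ j ∈ D, x ∈ ext j (stages ext j)) :
    ∃ j ∈ D, (s : Set X) ⊆ stages ext j ∪ ext j (stages ext j) := by
  classical
  have : Nonempty I := ⟨(h _ hs.choose_spec).choose⟩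
  choose! f hf using h
  obtain ⟨x, hx, hmax⟩ := s.exists_max_image f hs
  refine ⟨f x, (hf x hx).1, fun y hy => ?_⟩
  rcases (hmax y hy).lt_or_eq with h | h
  · exact Or.inl (mem_stages.2 ⟨f y, h, (hf y hy).2⟩)
  · exact Or.inr (h ▸ (hf y hy).2)

end Stages

section Regular

variable {μ : Cardinal.{u}}

/-- By König's theorem `μ < μ ^ cof μ`, which exceeds `μ^{<μ}` if `cof μ < μ`. -/
theorem isRegular_of_powerlt_self (h0 : ℵ₀ ≤ μ) (h : μ ^< μ = μ) : μ.IsRegular := by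
  refine ⟨h0, ?_⟩
  by_contra hlt
  have h1 := Cardinal.le_powerlt μ (not_le.1 hlt)
  rw [h] at h1
  exact absurd (Cardinal.lt_power_cof_ord h0) (not_lt.2 h1)

theorem mk_Iio_ord_lt (i : μ.ord.ToType) : #(Iio i) < μ := by
  simpa using Cardinal.mk_Iio_lt i (by simp)

/-- A property of finite character that survives each extension step holds at all stages. -/
theorem stages_good {X : Type u} (hμ : μ.IsRegular) (Good : Set X → Prop)
    (hmono : ∀ r s : Set X, r ⊆ s → Good s → Good r)
    (hfin : ∀ r : Set X, (∀ s : Finset X, ↑s ⊆ r → Good ↑s) → Good r)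
    (h0 : Good ∅) (ext : μ.ord.ToType → Set X → Set X)
    (hcard : ∀ i (r : Set X), #r < μ → Good r → #(ext i r) < μ)
    (hext : ∀ i (r : Set X), #r < μ → Good r → Good (r ∪ ext i r)) :
    (∀ i, #(stages ext i) < μ ∧ Good (stages ext i)) ∧ Good (⋃ i, ext i (stages ext i)) := by
  classical
  have key : ∀ i, #(stages ext i) < μ ∧ Good (stages ext i) := by
    intro i
    induction i using WellFoundedLT.induction with
    | ind i ih =>
      refine ⟨?_, hfin _ fun s hs => ?_⟩
      · rw [stages_eq, Cardinal.card_iUnion_lt_iff_forall_of_isRegular hμ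
          (mk_Iio_ord_lt i)]
        exact fun j => hcard _ _ (ih j j.2).1 (ih j j.2).2
      · rcases s.eq_empty_or_nonempty with rfl | hne
        · simpa using h0
        obtain ⟨j, hj, hsub⟩ := exists_stage_of_finset (ext := ext) hne (D := Iio i)
          fun x hx => by simpa using mem_stages.1 (hs hx)
        exact hmono _ _ hsub (hext j _ (ih j hj).1 (ih j hj).2)
  refine ⟨key, hfin _ fun s hs => ?_⟩
  rcases s.eq_empty_or_nonempty with rfl | hne
  · simpa using h0
  obtain ⟨j, -, hsub⟩ := exists_stage_of_finset (ext := ext) hne (D := univ)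
    fun x hx => by simpa using hs hx
  exact hmono _ _ hsub (hext j _ (key j).1 (key j).2)

/-- A small subset is enumerated by a proper initial segment of `μ`. There are `μ` such segments and
at most `μ^{<μ} = μ` enumerations along each. -/
theorem mk_small_subsets_le (h0 : ℵ₀ ≤ μ) (h : μ ^< μ = μ) {X : Type u} (hX : #X ≤ μ) :
    #{s : Set X // #s < μ} ≤ μ := by
  classical
  let I := μ.ord.ToType
  let f : (Σ i : I, (Iio i → Option X)) → Set X := fun p => {x | some x ∈ range p.2}
  have hsurj : ∀ s : {s : Set X // #s < μ}, ∃ p, f p = s := by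
    rintro ⟨s, hs⟩
    have : (#s).ord < Ordinal.type (α := I) (· < ·) := by
      rw [Ordinal.type_toType]
      exact Cardinal.ord_lt_ord.2 hs
    obtain ⟨i, hi⟩ : ∃ i : I, Ordinal.typein (α := I) (· < ·) i = (#s).ord :=
      ⟨Ordinal.enum (α := I) (· < ·) ⟨_, this⟩, by simp⟩
    have hc : #(Iio i) = #s := by
      have := congrArg Ordinal.card hi
      rw [Cardinal.card_ord] at this
      exact this
    obtain ⟨e⟩ := Cardinal.eq.1 hc
    refine ⟨⟨i, fun j => some (e j)⟩, ?_⟩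
    ext x
    simp only [f, mem_ofPred_eq, mem_range, Option.some.injEq]
    constructor
    · rintro ⟨y, rfl⟩; exact (e y).2
    · intro hx; exact ⟨e.symm ⟨x, hx⟩, by simp⟩
  choose g hg using hsurj
  have hginj : Function.Injective g := fun a b hab => Subtype.ext (by rw [← hg, ← hg, hab])
  refine (Cardinal.mk_le_of_injective hginj).trans ?_
  rw [Cardinal.mk_sigma]
  refine (Cardinal.sum_le_sum _ (fun _ => μ) fun i => ?_).trans ?_
  · rw [← Cardinal.power_def]
    have hO : #(Option X) ≤ μ := by
      rw [Cardinal.mk_option]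
      exact Cardinal.add_le_of_le h0 hX (Cardinal.one_le_aleph0.trans h0)
    calc #(Option X) ^ #(Iio i) ≤ μ ^ #(Iio i) := Cardinal.power_le_power_right hO
      _ ≤ μ ^< μ := Cardinal.le_powerlt _ (mk_Iio_ord_lt i)
      _ = μ := h
  · rw [Cardinal.sum_const']
    simp [I, Cardinal.mul_eq_self h0]

end Regular

/-! ### Compact structures -/

/-- The finite intersection property. -/
def FIP {X : Type u} (F : Set (Set X)) : Prop :=
  ∀ s : Finset (Set X), ↑s ⊆ F → (⋂₀ (↑s : Set (Set X))).Nonempty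

/-- Every family of fewer than `μ` parametrically definable sets with the finite intersection
property has a common point. -/
def IsCompactStructure (L : FirstOrder.Language.{u, u}) (μ : Cardinal.{u}) (N : Type u)
    [L.Structure N] : Prop :=
  ∀ (k : ℕ) (F : Set (Set (Fin k → N))), #F < μ → (∀ S ∈ F, (univ : Set N).Definable L S) →
    FIP F → (⋂₀ F).Nonempty

section

variable {L : FirstOrder.Language.{u, u}}

theorem mk_formula_le {μ : Cardinal.{u}} (h0 : ℵ₀ ≤ μ) (hL : L.card ≤ μ) {α : Type u}
    (hα : #α ≤ μ) : #(L.Formula α) ≤ μ := by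
  have h1 : #(L.Formula α) ≤ #(Σ n, L.BoundedFormula α n) :=
    Cardinal.mk_le_of_injective (f := fun φ => ⟨0, φ⟩) fun φ ψ h => by simpa using h
  refine h1.trans (BoundedFormula.card_le.trans (max_le h0 ?_))
  rw [Cardinal.lift_id, Cardinal.lift_id]
  exact Cardinal.add_le_of_le h0 hα hL

/-- `Γ` is finitely satisfiable in `N`. -/
def FinSat (N : Type u) [L.Structure N] {α : Type u} (Γ : Set (L.Formula α)) : Prop :=
  ∀ s : Finset (L.Formula α), ↑s ⊆ Γ → ∃ w : α → N, ∀ φ ∈ s, φ.Realize w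

theorem FinSat.mono {N : Type u} [L.Structure N] {α : Type u} {Γ Δ : Set (L.Formula α)}
    (h : FinSat N Δ) (hs : Γ ⊆ Δ) : FinSat N Γ := fun s h' => h s (h'.trans hs)

theorem finSat_of_finite {N : Type u} [L.Structure N] {α : Type u} {Γ : Set (L.Formula α)}
    (h : ∀ s : Finset (L.Formula α), ↑s ⊆ Γ → FinSat N (↑s : Set (L.Formula α))) : FinSat N Γ :=
  fun s hs => h s hs s subset_rfl

theorem exists_fresh {μ : Cardinal.{u}} (hμ : μ.IsRegular) {V : Set μ.ord.ToType} (hV : #V < μ)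
    (k : ℕ) : ∃ t : Fin k → μ.ord.ToType, Function.Injective t ∧ ∀ j, t j ∉ V := by
  have hinf : Infinite μ.ord.ToType := by
    rw [Cardinal.infinite_iff, Cardinal.mk_ord_toType]; exact hμ.aleph0_le
  have hc : #(Vᶜ : Set μ.ord.ToType) = μ := by
    have := Cardinal.mk_compl_of_infinite V (by simpa using hV)
    simpa using this
  have : Infinite (Vᶜ : Set μ.ord.ToType) := by
    rw [Cardinal.infinite_iff, hc]; exact hμ.aleph0_le
  let e : ℕ ↪ (Vᶜ : Set μ.ord.ToType) := Infinite.natEmbedding _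
  refine ⟨fun j => e j, fun i j hij => ?_, fun j => (e j).2⟩
  exact Fin.ext (e.injective (Subtype.ext hij))

theorem mk_biUnion_finset_lt {μ : Cardinal.{u}} (h0 : ℵ₀ < μ) (hμ : μ.IsRegular) {α β : Type u}
    {Γ : Set α} (hΓ : #Γ < μ) (f : α → Finset β) : #(⋃ φ ∈ Γ, (f φ : Set β)) < μ := by
  rw [Cardinal.card_biUnion_lt_iff_forall_of_isRegular hμ hΓ]
  intro a _
  exact (Cardinal.lt_aleph0_of_finite _).trans h0

/-- The instance of the set of formulas `Γ(x, z)` obtained by substituting new variables `t` for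
`z`. -/
def substNew {I : Type u} {k : ℕ} (t : Fin k → I) (Γ : Set (L.Formula (I ⊕ Fin k))) :
    Set (L.Formula I) :=
  (fun φ : L.Formula (I ⊕ Fin k) => φ.relabel (Sum.elim id t)) '' Γ

/-- The variables `t` occur neither in `Δ₀` nor freely in `Γ`, so an assignment `w` may be
overwritten by `z` there. -/
theorem finSat_substNew {N : Type u} [L.Structure N] {I : Type u} {k : ℕ} {t : Fin k → I}
    (ht : Function.Injective t) {Δ₀ : Set (L.Formula I)} {Γ : Set (L.Formula (I ⊕ Fin k))}
    [DecidableEq I]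
    (h1 : ∀ φ ∈ Δ₀, ∀ j, t j ∉ φ.freeVarFinset)
    (h2 : ∀ φ ∈ Γ, ∀ j, Sum.inl (t j) ∉ φ.freeVarFinset)
    (h : ∀ s : Finset (L.Formula I), ↑s ⊆ Δ₀ → ∀ s' : Finset (L.Formula (I ⊕ Fin k)), ↑s' ⊆ Γ →
      ∃ (w : I → N) (z : Fin k → N), (∀ φ ∈ s, φ.Realize w) ∧
        ∀ φ ∈ s', φ.Realize (Sum.elim w z)) :
    FinSat N (Δ₀ ∪ substNew t Γ) := by
  classical
  intro s hs
  obtain ⟨s', hs', hs''⟩ : ∃ s' : Finset (L.Formula (I ⊕ Fin k)), ↑s' ⊆ Γ ∧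
      s.filter (· ∉ Δ₀) ⊆ s'.image fun φ => φ.relabel (Sum.elim id t) := by
    have : ∀ φ ∈ s.filter (· ∉ Δ₀), ∃ ψ ∈ Γ, ψ.relabel (Sum.elim id t) = φ := by
      intro φ hφ
      rw [Finset.mem_filter] at hφ
      exact (hs hφ.1).resolve_left hφ.2
    choose! g hg using this
    refine ⟨(s.filter (· ∉ Δ₀)).image g, ?_, ?_⟩
    · intro ψ hψ
      simp only [Finset.coe_image, mem_image, Finset.mem_coe] at hψ
      obtain ⟨φ, hφ, rfl⟩ := hψ
      exact (hg φ hφ).1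
    · intro φ hφ
      rw [Finset.mem_image]
      exact ⟨g φ, Finset.mem_image_of_mem _ hφ, (hg φ hφ).2⟩
  obtain ⟨w, z, hw, hz⟩ := h (s.filter (· ∈ Δ₀)) (by intro φ hφ; simpa using (Finset.mem_filter.1
    (Finset.mem_coe.1 hφ)).2) s' hs'
  let w' : I → N := fun i => if hi : ∃ j, t j = i then z hi.choose else w i
  have hw't : ∀ j, w' (t j) = z j := by
    intro j
    have hi : ∃ j', t j' = t j := ⟨j, rfl⟩
    simp only [w', dif_pos hi]
    rw [ht hi.choose_spec]
  have hw'n : ∀ i, (∀ j, t j ≠ i) → w' i = w i := by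
    intro i hi
    simp only [w']
    rw [dif_neg]
    push Not
    exact hi
  refine ⟨w', fun φ hφ => ?_⟩
  by_cases hφΔ : φ ∈ Δ₀
  · refine (realize_congr_freeVar φ fun i hi => hw'n i ?_).2 (hw φ (by simp [hφ, hφΔ]))
    rintro j rfl
    exact h1 φ hφΔ j hi
  · obtain ⟨ψ, hψ, rfl⟩ := Finset.mem_image.1 (hs'' (by simp [hφ, hφΔ] : φ ∈ _))
    rw [Formula.realize_relabel]
    refine (realize_congr_freeVar ψ fun i hi => ?_).2 (hz ψ hψ)
    rcases i with i | j
    · refine hw'n i ?_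
      rintro j rfl
      exact h2 ψ (hs' hψ) j hi
    · exact hw't j

/-- A maximal finitely satisfiable set of formulas in `μ` variables that has witnesses for all sets
of fewer than `μ` formulas. -/
theorem exists_saturated_diagram {μ : Cardinal.{u}} (hμ : ℵ₀ < μ) (hpow : μ ^< μ = μ)
    (hL : L.card ≤ μ) (N : Type u) [L.Structure N] [Nonempty N] :
    ∃ Δ : Set (L.Formula μ.ord.ToType), FinSat N Δ ∧
      ∀ (k : ℕ) (Γ : Set (L.Formula (μ.ord.ToType ⊕ Fin k))), #Γ < μ →
        (∀ s : Finset (L.Formula μ.ord.ToType), ↑s ⊆ Δ →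
          ∀ s' : Finset (L.Formula (μ.ord.ToType ⊕ Fin k)), ↑s' ⊆ Γ →
            ∃ (w : μ.ord.ToType → N) (z : Fin k → N), (∀ φ ∈ s, φ.Realize w) ∧
              ∀ φ ∈ s', φ.Realize (Sum.elim w z)) →
        ∃ t : Fin k → μ.ord.ToType, substNew t Γ ⊆ Δ := by
  classical
  have hreg := isRegular_of_powerlt_self hμ.le hpow
  let I := μ.ord.ToType
  let Task := Σ k : ULift.{u} ℕ, {Γ : Set (L.Formula (I ⊕ Fin k.down)) // #Γ < μ}
  have hTask : #Task ≤ μ := by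
    rw [Cardinal.mk_sigma]
    refine (Cardinal.sum_le_sum _ (fun _ => μ) fun k => ?_).trans ?_
    · refine mk_small_subsets_le hμ.le hpow (mk_formula_le hμ.le hL ?_)
      rw [Cardinal.mk_sum, Cardinal.lift_uzero, Cardinal.mk_ord_toType]
      refine Cardinal.add_le_of_le hμ.le le_rfl ?_
      simpa using Cardinal.natCast_lt_aleph0.le.trans hμ.le
    · rw [Cardinal.sum_const', Cardinal.mk_uLift]
      simpa using Cardinal.mul_le_of_le hμ.le hμ.le le_rfl
  obtain ⟨g, hg⟩ : ∃ g : I → Task, Function.Surjective g := by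
    have : Nonempty Task := ⟨⟨⟨0⟩, ⟨∅, by simpa using hμ.pos⟩⟩⟩
    obtain ⟨⟨g, hg⟩⟩ : #Task ≤ #I := by simpa [I] using hTask
    exact ⟨Function.invFun g, Function.invFun_surjective hg⟩
  -- Fewer than `μ` formulas contain fewer than `μ` variables, so fresh ones remain at every stage.
  have hfresh : ∀ (i : I) (r : Set (L.Formula I)), #r < μ →
      ∃ t : Fin (g i).1.down → I, Function.Injective t ∧
        (∀ φ ∈ r, ∀ j, t j ∉ φ.freeVarFinset) ∧
        ∀ φ ∈ ((g i).2 : Set (L.Formula (I ⊕ Fin (g i).1.down))), ∀ j, Sum.inl (t j) ∉ BoundedFormula.freeVarFinset φ := by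
    intro i r hr
    let V : Set I := (⋃ φ ∈ r, (φ.freeVarFinset : Set I)) ∪
      ⋃ φ ∈ ((g i).2 : Set (L.Formula (I ⊕ Fin (g i).1.down))), (φ.freeVarFinset.toLeft : Set I)
    have hV : #V < μ := by
      refine (Cardinal.mk_union_le _ _).trans_lt (Cardinal.add_lt_of_lt hμ.le ?_ ?_)
      · exact mk_biUnion_finset_lt hμ hreg hr _
      · exact mk_biUnion_finset_lt hμ hreg (g i).2.2 _
    obtain ⟨t, ht, htV⟩ := exists_fresh hreg hV (g i).1.down
    refine ⟨t, ht, fun φ hφ j hj => htV j (Or.inl ?_), fun φ hφ j hj => htV j (Or.inr ?_)⟩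
    · exact mem_biUnion hφ hj
    · exact mem_biUnion hφ (by simpa using hj)
  have hI : Nonempty I := Cardinal.mk_ne_zero_iff.1 (by simpa [I] using hμ.ne_bot)
  choose! t ht using hfresh
  let ext : I → Set (L.Formula I) → Set (L.Formula I) := fun i r =>
    if FinSat N (r ∪ substNew (t i r) (g i).2) then substNew (t i r) (g i).2 else ∅
  obtain ⟨hst, hall⟩ := stages_good hreg (FinSat N) (fun r s hrs h => h.mono hrs)
    (fun r h => finSat_of_finite h) (fun s hs => ⟨fun _ => Classical.arbitrary N, fun φ hφ =>
      absurd (hs hφ) (by simp)⟩) ext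
    (by
      intro i r _ _
      simp only [ext]
      split_ifs
      · exact Cardinal.mk_image_le.trans_lt (g i).2.2
      · simpa using hμ.pos)
    (by
      intro i r _ hr
      simp only [ext]
      split_ifs with h
      · exact h
      · simpa using hr)
  refine ⟨_, hall, fun k Γ hΓ h => ?_⟩
  obtain ⟨i, hi⟩ := hg ⟨⟨k⟩, ⟨Γ, hΓ⟩⟩
  have hsub : stages ext i ⊆ ⋃ i, ext i (stages ext i) := by
    intro x hx
    obtain ⟨j, -, hj⟩ := mem_stages.1 hx
    exact mem_iUnion.2 ⟨j, hj⟩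
  have h1 := ht i (stages ext i) (hst i).1
  -- Since `Γ` is finitely satisfiable together with the final set, it passes the test at the stage
  -- that treats it; one visit per task is enough.
  have h2 : ext i (stages ext i) = substNew (t i (stages ext i)) (g i).2 := by
    simp only [ext]
    rw [if_pos]
    refine finSat_substNew h1.1 h1.2.1 h1.2.2 ?_
    rw [hi]
    exact fun s hs s' hs' => h s (hs.trans hsub) s' hs'
  have h3 : ∃ t : Fin (g i).1.down → I, substNew t (g i).2 ⊆ ⋃ i, ext i (stages ext i) :=
    ⟨_, h2 ▸ subset_iUnion (fun i => ext i (stages ext i)) i⟩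
  rw [hi] at h3
  exact h3

end

section

variable {L : FirstOrder.Language.{u, u}}

/-- The structure consists of the values of the `μ` variables in a model of the saturated diagram.
Witnesses for single formulas give the Tarski–Vaught test, and witnesses for small sets of formulas
give compactness. -/
theorem exists_compactStructure [L.IsRelational] {μ : Cardinal.{u}} (hμ : ℵ₀ < μ)
    (hpow : μ ^< μ = μ) (hL : L.card ≤ μ) (N : Type u) [L.Structure N] [Nonempty N] :
    ∃ (N' : Type u) (_ : L.Structure N') (_ : Nonempty N'), (N' ≅[L] N) ∧ #N' ≤ μ ∧
      IsCompactStructure L μ N' := by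
  classical
  let I := μ.ord.ToType
  obtain ⟨Δ, hΔ, hwit⟩ := exists_saturated_diagram hμ hpow hL N
  obtain ⟨M, _, _, hMN, v, hv⟩ := exists_model_realizing Δ hΔ
  -- The diagram tests satisfiability in `N`; finite satisfiability in `M` goes back to `N` by
  -- elementary equivalence.
  have key : ∀ (k : ℕ) (Γ : Set (L.Formula (I ⊕ Fin k))), #Γ < μ →
      (∀ s : Finset (L.Formula (I ⊕ Fin k)), ↑s ⊆ Γ →
        ∃ z : Fin k → M, ∀ φ ∈ s, φ.Realize (Sum.elim v z)) →
      ∃ t : Fin k → I, ∀ φ ∈ Γ, φ.Realize (Sum.elim v (v ∘ t)) := by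
    intro k Γ hΓ h
    obtain ⟨t, ht⟩ := hwit k Γ hΓ (by
      intro s hs s' hs'
      obtain ⟨z, hz⟩ := h s' hs'
      obtain ⟨w, hw⟩ := exists_realize_of_elementarilyEquivalent hMN
        (s.image (fun φ => φ.relabel Sum.inl) ∪ s') (Sum.elim v z) (by
          intro φ hφ
          rcases Finset.mem_union.1 hφ with h1 | h1
          · obtain ⟨ψ, hψ, rfl⟩ := Finset.mem_image.1 h1
            rw [Formula.realize_relabel]
            exact hv ψ (hs hψ)
          · exact hz φ h1)
      refine ⟨w ∘ Sum.inl, w ∘ Sum.inr, fun φ hφ => ?_, fun φ hφ => ?_⟩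
      · have := hw _ (Finset.mem_union_left _ (Finset.mem_image_of_mem _ hφ))
        rwa [Formula.realize_relabel] at this
      · rw [Sum.elim_comp_inl_inr]
        exact hw φ (Finset.mem_union_right _ hφ))
    refine ⟨t, fun φ hφ => ?_⟩
    have := hv _ (ht ⟨φ, hφ, rfl⟩)
    rwa [Formula.realize_relabel, Sum.comp_elim, Function.comp_id] at this
  let S : L.Substructure M := induced (range v)
  have hS : ∀ y : S, ∃ i : I, v i = y := fun y => y.2
  choose ι hι using hS
  let E : L.ElementarySubstructure M := S.toElementarySubstructure (by
    intro n φ x a ha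
    let φ' : L.Formula (I ⊕ Fin 1) := (φ.toFormula).relabel
      (Sum.elim Empty.elim (Fin.snoc (α := fun _ => I ⊕ Fin 1) (fun j => Sum.inl (ι (x j))) (Sum.inr 0)))
    have hφ' : ∀ z : Fin 1 → M, φ'.Realize (Sum.elim v z) ↔
        φ.Realize default (Fin.snoc ((↑) ∘ x) (z 0) : _ → M) := by
      intro z
      simp only [φ']
      rw [Formula.realize_relabel, BoundedFormula.realize_toFormula]
      refine iff_of_eq (congrArg₂ _ (Subsingleton.elim _ _) ?_)
      funext j
      refine Fin.lastCases ?_ (fun j => ?_) j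
      · simp
      · simp [hι]
    obtain ⟨t, ht⟩ := key 1 {φ'} (by simpa using Cardinal.one_lt_aleph0.trans hμ) (by
      intro s hs
      refine ⟨fun _ => a, fun ψ hψ => ?_⟩
      obtain rfl : ψ = φ' := hs hψ
      exact (hφ' _).2 ha)
    exact ⟨⟨v (t 0), mem_range_self _⟩, (hφ' _).1 (ht φ' rfl)⟩)
  have hEv : ∀ i, v i ∈ E := fun i => mem_range_self (f := v) i
  have hιE : ∀ y : E, v (ι y) = y := fun y => hι y
  refine ⟨E, inferInstance, ⟨⟨v (Classical.choice (Cardinal.mk_ne_zero_iff.1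
    (by simpa [I] using hμ.ne_bot))), hEv _⟩⟩, E.elementarilyEquivalent.trans hMN, ?_, ?_⟩
  · have : Function.Injective fun y : E => ι y := fun y y' h => Subtype.ext (by
      rw [← hιE y, ← hιE y']; exact congrArg v h)
    simpa [I] using Cardinal.mk_le_of_injective this
  · intro k F hF hdef hfip
    have : ∀ S ∈ F, ∃ φ : L.Formula (I ⊕ Fin k), ∀ x : Fin k → E,
        x ∈ S ↔ φ.Realize (Sum.elim v (fun j => (x j : M))) := by
      intro S hS
      obtain ⟨φ, hφ⟩ := definable_iff_exists_formula_sum.1 (hdef S hS)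
      refine ⟨φ.relabel (Sum.map (fun y => ι y.1) id), fun x => ?_⟩
      rw [Formula.realize_relabel, hφ, mem_ofPred_eq, ← E.subtype.map_formula]
      refine iff_of_eq (congrArg _ ?_)
      funext y
      rcases y with y | y
      · simp [hιE]
      · simp
    choose! f hf using this
    obtain ⟨t, ht⟩ := key k (f '' F) (Cardinal.mk_image_le.trans_lt hF) (by
      intro s hs
      have hs' : ∀ φ ∈ s, ∃ S ∈ F, f S = φ := fun φ hφ => hs hφ
      choose! g hg using hs'
      obtain ⟨x, hx⟩ := hfip (s.image g) (by
        intro S hS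
        obtain ⟨φ, hφ, rfl⟩ := Finset.mem_image.1 (Finset.mem_coe.1 hS)
        exact (hg φ hφ).1)
      refine ⟨fun j => x j, fun φ hφ => ?_⟩
      have := mem_sInter.1 hx (g φ) (by simpa using ⟨φ, hφ, rfl⟩)
      rw [hf _ (hg φ hφ).1, (hg φ hφ).2] at this
      exact this)
    exact ⟨fun j => ⟨v (t j), hEv _⟩, mem_sInter.2 fun S hS => (hf S hS _).2 (ht _ ⟨S, hS, rfl⟩)⟩

end

/-! ### Elementary embeddings into the monster model -/

section

variable {L : FirstOrder.Language.{u, u}} {C N : Type u} [L.Structure C] [L.Structure N]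

/-- `G` is the graph of a partial elementary map. -/
def IsElementaryGraph (L : FirstOrder.Language.{u, u}) {N C : Type u} [L.Structure N]
    [L.Structure C] (G : Set (N × C)) : Prop :=
  ∀ (k : ℕ) (φ : L.Formula (Fin k)) (g : Fin k → N × C), (∀ i, g i ∈ G) →
    (φ.Realize (fun i => (g i).1) ↔ φ.Realize fun i => (g i).2)

theorem IsElementaryGraph.eq_iff {G : Set (N × C)} (hG : IsElementaryGraph L G) {p q : N × C}
    (hp : p ∈ G) (hq : q ∈ G) : p.1 = q.1 ↔ p.2 = q.2 := by
  have := hG 2 ((Term.var 0).equal (Term.var 1)) ![p, q] (by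
    intro i; fin_cases i <;> simpa)
  simpa [Formula.realize_equal] using this

theorem IsElementaryGraph.realize_iff {G : Set (N × C)} (hG : IsElementaryGraph L G)
    (φ : L.Formula G) :
    φ.Realize (fun i : G => (i : N × C).1) ↔ φ.Realize fun i : G => (i : N × C).2 := by
  obtain ⟨k, ψ, t, h⟩ := exists_fin_formula φ
  rw [h, h]
  exact hG k ψ (fun i => t i) fun i => (t i).2

variable {T : L.Theory} [Nonempty C] {κ : Cardinal.{u}}

/-- Saturation in the form used below, with families of definable sets in place of types. -/
theorem IsMonster.nonempty_sInter (hC : IsMonster κ T C) {D : Set C} (hD : #D < κ) {n : ℕ}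
    {F : Set (Set (Fin n → C))} (hdef : ∀ S ∈ F, D.Definable L S) (hF : FIP F) :
    (⋂₀ F).Nonempty := by
  classical
  obtain ⟨p, hp⟩ := exists_completeType (L := L[[D]]) (N := C)
    {φ : (L[[D]]).Formula (Fin n) | Set.ofPred φ.Realize ∈ F} (by
      intro s hs
      obtain ⟨w, hw⟩ := hF (s.image fun φ => Set.ofPred φ.Realize) (by
        intro S hS
        obtain ⟨φ, hφ, rfl⟩ := Finset.mem_image.1 (Finset.mem_coe.1 hS)
        exact hs hφ)
      exact ⟨w, fun φ hφ => mem_sInter.1 hw _ (Finset.mem_coe.2 (Finset.mem_image_of_mem _ hφ))⟩)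
  obtain ⟨c, rfl⟩ := hC.saturated D hD n p
  refine ⟨c, mem_sInter.2 fun S hS => ?_⟩
  obtain ⟨φ, rfl⟩ := hdef S hS
  exact Theory.CompleteType.formula_mem_typeOf.1 (hp φ hS)

/-- The type of `x` over the domain of `G`, moved along `G`, is finitely satisfiable because
existential formulas are preserved; saturation realizes it. `G` is injective, so there are fewer
than `κ` parameters. -/
theorem IsMonster.extend_graph (hC : IsMonster κ T C) {G : Set (N × C)} (hNκ : #N < κ)
    (hG : IsElementaryGraph L G) (x : N) : ∃ y : C, IsElementaryGraph L (insert (x, y) G) := by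
  classical
  let F : Set (Set (Fin 1 → C)) := (fun φ : L.Formula (G ⊕ Fin 1) =>
    {y | φ.Realize (Sum.elim (fun i : G => (i : N × C).2) y)}) ''
      {φ | φ.Realize (Sum.elim (fun i : G => (i : N × C).1) fun _ => x)}
  have hD : #(Prod.snd '' G) < κ := by
    refine (Cardinal.mk_image_le.trans ?_).trans_lt hNκ
    refine Cardinal.mk_le_of_injective (f := fun p : G => (p : N × C).1) fun p q h => ?_
    exact Subtype.ext (Prod.ext h ((hG.eq_iff p.2 q.2).1 h))
  obtain ⟨y, hy⟩ := hC.nonempty_sInter (F := F) hD (by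
    rintro _ ⟨φ, -, rfl⟩
    refine definable_iff_exists_formula_sum.2
      ⟨φ.relabel (Sum.map (fun i : G => ⟨(i : N × C).2, mem_image_of_mem _ i.2⟩) id), ?_⟩
    ext y
    rw [mem_ofPred_eq, mem_ofPred_eq, Formula.realize_relabel]
    refine iff_of_eq (congrArg _ ?_)
    funext i
    rcases i with i | i <;> rfl) (by
    intro s hs
    have hs' : ∀ S ∈ s, ∃ φ : L.Formula (G ⊕ Fin 1),
        φ.Realize (Sum.elim (fun i : G => (i : N × C).1) fun _ => x) ∧
        {y | φ.Realize (Sum.elim (fun i : G => (i : N × C).2) y)} = S := fun S hS => hs hS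
    choose! f hf using hs'
    let χ : L.Formula G := (Formula.iInf fun S : s => f S).iExs (Fin 1)
    have h1 : χ.Realize fun i : G => (i : N × C).1 := by
      simp only [χ]
      rw [Formula.realize_iExs]
      exact ⟨fun _ => x, Formula.realize_iInf.2 fun S => (hf S S.2).1⟩
    rw [hG.realize_iff] at h1
    simp only [χ] at h1
    rw [Formula.realize_iExs] at h1
    obtain ⟨y, hy⟩ := h1
    rw [Formula.realize_iInf] at hy
    refine ⟨y, mem_sInter.2 fun S hS => ?_⟩
    rw [← (hf S hS).2]
    exact hy ⟨S, hS⟩)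
  refine ⟨y 0, fun k φ g hg => ?_⟩
  have hconst : (fun _ => y 0) = y := by funext i; rw [Subsingleton.elim i 0]
  let r : Fin k → G ⊕ Fin 1 := fun i => if h : g i ∈ G then Sum.inl ⟨g i, h⟩ else Sum.inr 0
  have hg1 : (fun i => (g i).1) = Sum.elim (fun i : G => (i : N × C).1) (fun _ => x) ∘ r := by
    funext i
    by_cases h : g i ∈ G
    · simp [r, h]
    · simp only [Function.comp, r, dif_neg h, Sum.elim_inr]
      rw [(hg i).resolve_right h]
  have hg2 : (fun i => (g i).2) = Sum.elim (fun i : G => (i : N × C).2) y ∘ r := by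
    funext i
    by_cases h : g i ∈ G
    · simp [r, h]
    · simp only [Function.comp, r, dif_neg h, Sum.elim_inr]
      rw [(hg i).resolve_right h]
  have key : ∀ ψ : L.Formula (Fin k), ψ.Realize (fun i => (g i).1) →
      ψ.Realize (fun i => (g i).2) := by
    intro ψ hψ
    rw [hg1, ← Formula.realize_relabel] at hψ
    rw [hg2, ← Formula.realize_relabel]
    exact mem_sInter.1 hy _ ⟨_, hψ, rfl⟩
  refine ⟨key φ, fun h => ?_⟩
  by_contra hn
  exact Formula.realize_not.1 (key φ.not (Formula.realize_not.2 hn)) h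

/-- A maximal elementary graph is total, by `IsMonster.extend_graph`. -/
theorem IsMonster.exists_elementaryEmbedding (hC : IsMonster κ T C) [Nonempty N] (hNκ : #N < κ)
    (hNC : N ≅[L] C) : Nonempty (N ↪ₑ[L] C) := by
  classical
  obtain ⟨G, hG⟩ := zorn_subset {G : Set (N × C) | IsElementaryGraph L G} (by
    intro c hc hchain
    rcases c.eq_empty_or_nonempty with rfl | hne
    -- The empty graph is elementary exactly because `N` and `C` satisfy the same sentences.
    · refine ⟨∅, fun k φ g hg => ?_, by simp⟩
      have : IsEmpty (Fin k) := ⟨fun i => hg i⟩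
      have key : ∀ ψ : L.Formula (Fin k), ψ.Realize (fun i => (g i).1) →
          ψ.Realize (fun i => (g i).2) := by
        intro ψ hψ
        obtain ⟨w, hw⟩ := exists_realize_of_elementarilyEquivalent hNC {ψ} _ (by simpa using hψ)
        rw [Subsingleton.elim (fun i => (g i).2) w]
        exact hw ψ (by simp)
      refine ⟨key φ, fun h => ?_⟩
      by_contra hn
      exact Formula.realize_not.1 (key φ.not (Formula.realize_not.2 hn)) h
    · refine ⟨⋃₀ c, fun k φ g hg => ?_, fun s hs => subset_sUnion_of_mem hs⟩
      obtain ⟨G, hG, hsub⟩ := DirectedOn.exists_mem_subset_of_finite_of_subset_sUnion hne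
        hchain.directedOn (finite_range g) (range_subset_iff.2 hg)
      exact hc hG k φ g fun i => hsub (mem_range_self i))
  have htot : ∀ x : N, ∃ y, (x, y) ∈ G := by
    intro x
    obtain ⟨y, hy⟩ := hC.extend_graph hNκ hG.prop x
    exact ⟨y, hG.le_of_ge hy (subset_insert _ _) (mem_insert _ _)⟩
  choose f hf using htot
  exact ⟨⟨f, fun n φ x => (hG.prop n φ (fun i => (x i, f (x i))) fun i => hf _).symm⟩⟩

end

/-! ### Sets definable with parameters -/

section Definability

variable {L : FirstOrder.Language.{u, u}} {C : Type u} [L.Structure C]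

theorem definable_ofPred {α : Type*} (φ : L.Formula α) (D : Set C) :
    D.Definable L {v : α → C | φ.Realize v} :=
  (empty_definable_iff.2 ⟨φ, rfl⟩).mono (empty_subset _)

theorem definable_fiber {α β : Type*} {D : Set C} {S : Set (α ⊕ β → C)} (hS : D.Definable L S)
    (p : β → C) (hp : ∀ i, p i ∈ D) : D.Definable L {x : α → C | Sum.elim x p ∈ S} := by
  obtain ⟨φ, rfl⟩ := definable_iff_exists_formula_sum.1 hS
  refine definable_iff_exists_formula_sum.2
    ⟨φ.relabel (Sum.elim Sum.inl (Sum.elim Sum.inr fun i => Sum.inl ⟨p i, hp i⟩)), ?_⟩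
  ext x
  simp only [mem_ofPred_eq, Formula.realize_relabel]
  refine iff_of_eq (congrArg _ ?_)
  funext i
  rcases i with i | i | i <;> rfl

theorem definable_fiber_left {α β : Type*} {D : Set C} {S : Set (α ⊕ β → C)}
    (hS : D.Definable L S) (p : α → C) (hp : ∀ i, p i ∈ D) :
    D.Definable L {x : β → C | Sum.elim p x ∈ S} := by
  convert definable_fiber (hS.preimage_comp (Sum.swap : α ⊕ β → β ⊕ α)) p hp using 1
  ext x
  simp only [mem_ofPred_eq, mem_preimage]
  refine iff_of_eq (congrArg (· ∈ S) ?_)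
  funext i
  rcases i with i | i <;> rfl

theorem exists_formula_of_definable {α : Type*} {D : Set C} {S : Set (α → C)}
    (hS : D.Definable L S) : ∃ (k : ℕ) (φ : L.Formula (α ⊕ Fin k)) (b : Fin k → D),
      ∀ x, x ∈ S ↔ φ.Realize (Sum.elim x fun i => (b i : C)) := by
  classical
  obtain ⟨A₀, hA₀, hdef⟩ := definable_iff_finitely_definable.1 hS
  obtain ⟨φ, rfl⟩ := definable_iff_exists_formula_sum.1 hdef
  let e := Fintype.equivFin A₀
  refine ⟨_, φ.relabel (Sum.elim (fun a => Sum.inr (e a)) Sum.inl),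
    fun i => ⟨e.symm i, hA₀ (e.symm i).2⟩, fun x => ?_⟩
  rw [Formula.realize_relabel, mem_ofPred_eq]
  refine iff_of_eq (congrArg _ ?_)
  funext i
  rcases i with i | i
  · simp
  · rfl

theorem definable_iff_fiber {α : Type*} {D : Set C} {S : Set (α → C)} :
    D.Definable L S ↔ ∃ (k : ℕ) (φ : L.Formula (α ⊕ Fin k)) (b : Fin k → C), (∀ i, b i ∈ D) ∧
      S = {x | φ.Realize (Sum.elim x b)} := by
  constructor
  · intro h
    obtain ⟨k, φ, b, hb⟩ := exists_formula_of_definable h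
    exact ⟨k, φ, fun i => b i, fun i => (b i).2, ext hb⟩
  · rintro ⟨k, φ, b, hb, rfl⟩
    exact definable_fiber (definable_ofPred φ D) b hb

theorem definable_pPart (P : L.Relations 1) (D : Set C) (j : ℕ) {α : Type*} (f : Fin j → α) :
    D.Definable L {v : α → C | ∀ i, v (f i) ∈ PPart C P} := by
  convert definable_ofPred (Formula.iInf fun i => P.formula ![Term.var (f i)]) D using 1
  ext v
  simp only [mem_ofPred_eq, Formula.realize_iInf, Formula.realize_rel, PPart]
  refine forall_congr' fun i => iff_of_eq (congrArg _ ?_)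
  funext k
  simp

theorem definable_sInter {α : Type*} {D : Set C} (s : Finset (Set (α → C)))
    (hs : ∀ S ∈ s, D.Definable L S) : D.Definable L (⋂₀ (↑s : Set (Set (α → C)))) := by
  classical
  induction s using Finset.induction_on with
  | empty => simp
  | insert S s _ ih =>
    rw [Finset.coe_insert, sInter_insert]
    exact (hs S (by simp)).inter (ih fun S' hS' => hs S' (by simp [hS']))

end Definability

/-! ### Completeness over `P` and the tree of types -/

section

variable {L : FirstOrder.Language.{u, u}} {C : Type u} [L.Structure C]

/-- Families of fewer than `μ` sets definable over `D` that are finitely satisfiable in `B` are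
satisfiable in `B`. -/
def IsCompactIn (L : FirstOrder.Language.{u, u}) {C : Type u} [L.Structure C] (μ : Cardinal.{u})
    (D B : Set C) : Prop :=
  ∀ (k : ℕ) (F : Set (Set (Fin k → C))), #F < μ → (∀ S ∈ F, D.Definable L S) →
    (∀ s : Finset (Set (Fin k → C)), ↑s ⊆ F →
      ∃ x ∈ ⋂₀ (↑s : Set (Set (Fin k → C))), ∀ i, x i ∈ B) →
    ∃ x ∈ ⋂₀ F, ∀ i, x i ∈ B

theorem IsCompactIn.mono {μ : Cardinal.{u}} {D D' B : Set C} (h : IsCompactIn L μ D B)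
    (hD : D' ⊆ D) : IsCompactIn L μ D' B :=
  fun k F hF hdef => h k F hF fun S hS => (hdef S hS).mono hD

/-- The form in which compactness is applied: the index is a finite set of conditions, and one tuple
of `B` has to serve all of them. -/
theorem IsCompactIn.exists_of_directed {μ : Cardinal.{u}} {D B : Set C}
    (h : IsCompactIn L μ D B) {ι : Type u} [Nonempty ι] (hι : #ι < μ) {k : ℕ}
    (V : ι → Set (Fin k → C)) (hV : ∀ i, D.Definable L (V i)) (hdir : Directed (· ⊇ ·) V)
    (hne : ∀ i, ∃ x ∈ V i, ∀ j, x j ∈ B) : ∃ x, (∀ i, x ∈ V i) ∧ ∀ j, x j ∈ B := by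
  classical
  obtain ⟨x, hx, hxB⟩ := h k (range V) (Cardinal.mk_range_le.trans_lt hι)
    (by rintro _ ⟨i, rfl⟩; exact hV i) (by
    intro s hs
    have : ∃ i, ∀ S ∈ s, V i ⊆ S := by
      induction s using Finset.induction_on with
      | empty => exact ⟨Classical.arbitrary ι, by simp⟩
      | insert S s _ ih =>
        obtain ⟨i, hi⟩ := ih fun S' hS' => hs (by simp [Finset.mem_coe.1 hS'])
        obtain ⟨j, rfl⟩ := hs (by simp : S ∈ _)
        obtain ⟨k, hk1, hk2⟩ := hdir i j
        refine ⟨k, fun S' hS' => ?_⟩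
        rcases Finset.mem_insert.1 hS' with rfl | h'
        · exact hk2
        · exact hk1.trans (hi S' h')
    obtain ⟨i, hi⟩ := this
    obtain ⟨x, hx, hxB⟩ := hne i
    exact ⟨x, mem_sInter.2 fun S hS => hi S hS hx, hxB⟩)
  exact ⟨x, fun i => mem_sInter.1 hx _ (mem_range_self i), hxB⟩

/-- A nonempty `D`-definable relation on `P^C` has a point in `P^C ∩ B`. -/
def IsStarComplete (P : L.Relations 1) (D B : Set C) : Prop :=
  ∀ (k : ℕ) (S : Set (Fin k → C)), D.Definable L S → (∃ x ∈ S, ∀ i, x i ∈ PPart C P) →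
    ∃ x ∈ S, ∀ i, x i ∈ PPart C P ∩ B

theorem IsStarComplete.mono {P : L.Relations 1} {D D' B : Set C} (h : IsStarComplete P D B)
    (hD : D' ⊆ D) : IsStarComplete P D' B :=
  fun k S hS => h k S (hS.mono hD)

theorem isCompleteSet_iff {P : L.Relations 1} {A : Set C} :
    IsCompleteSet P A ↔ IsStarComplete P A A := by
  constructor
  · intro h k S hS ⟨x, hx, hxP⟩
    obtain ⟨m, φ, b, hb⟩ := exists_formula_of_definable hS
    obtain ⟨a, ha, ha'⟩ := h k m φ b ⟨x, hxP, (hb x).1 hx⟩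
    exact ⟨a, (hb a).2 ha', ha⟩
  · intro h n m ψ b ⟨x, hxP, hx⟩
    obtain ⟨a, ha, ha'⟩ := h n {x | ψ.Realize (Sum.elim x fun i => (b i : C))}
      (definable_iff_fiber.2 ⟨m, ψ, _, fun i => (b i).2, rfl⟩) ⟨x, hx, hxP⟩
    exact ⟨a, ha', ha⟩

/-- The left side merges the two requirements on types in `S_*(B)`. Applied to the singleton of a
point of `P ∩ (B ∪ c)`, it puts that point into `B`. -/
theorem isStarComplete_iff {P : L.Relations 1} {B : Set C} {n : ℕ} {c : Fin n → C} :
    IsStarComplete P (B ∪ range c) B ↔ PPart C P ∩ (B ∪ range c) = PPart C P ∩ B ∧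
      IsCompleteSet P (B ∪ range c) := by
  rw [isCompleteSet_iff]
  constructor
  · intro h
    refine ⟨?_, ?_⟩
    · ext y
      refine ⟨fun ⟨hy, hy'⟩ => ?_, fun ⟨hy, hy'⟩ => ⟨hy, Or.inl hy'⟩⟩
      obtain ⟨x, hx, hxB⟩ := h 1 {x | x 0 = y} (by
        have := definable_fiber (definable_ofPred (L := L) ((Term.var (Sum.inl 0)).equal
          (Term.var (Sum.inr 0)) : L.Formula (Fin 1 ⊕ Fin 1)) (B ∪ range c)) (fun _ => y)
          fun _ => hy'
        simpa [Formula.realize_equal] using this) ⟨fun _ => y, rfl, fun _ => hy⟩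
      have : x 0 = y := hx
      exact this ▸ hxB 0
    · intro k S hS hx
      obtain ⟨x, hx, hxB⟩ := h k S hS hx
      exact ⟨x, hx, fun i => ⟨(hxB i).1, Or.inl (hxB i).2⟩⟩
  · rintro ⟨h1, h2⟩ k S hS hx
    obtain ⟨x, hx, hxB⟩ := h2 k S hS hx
    exact ⟨x, hx, fun i => h1 ▸ hxB i⟩

theorem mem_starTypes_iff [Nonempty C] {P : L.Relations 1} {B : Set C} {n : ℕ}
    {p : TypeOver L B n} :
    p ∈ StarTypes P B n ↔ ∃ c : Fin n → C, tp B c = p ∧ IsStarComplete P (B ∪ range c) B := by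
  simp only [isStarComplete_iff]; rfl

/-- Parameters from `c` can be replaced by variables. The requirements then depend on `B` only, so
they can be listed before `c` has been constructed. -/
theorem isStarComplete_of_witnesses {P : L.Relations 1} {B : Set C} {n : ℕ} {c : Fin n → C}
    (h : ∀ (j : ℕ) (Y : Set (Fin n ⊕ Fin j → C)), B.Definable L Y →
      (∃ z : Fin j → C, (∀ i, z i ∈ PPart C P) ∧ Sum.elim c z ∈ Y) →
      ∃ z : Fin j → C, (∀ i, z i ∈ PPart C P ∩ B) ∧ Sum.elim c z ∈ Y) :
    IsStarComplete P (B ∪ range c) B := by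
  classical
  intro k S hS ⟨x, hx, hxP⟩
  obtain ⟨m, φ, b, hb, rfl⟩ := definable_iff_fiber.1 hS
  have hb' : ∀ i, ∃ s : B ⊕ Fin n, Sum.elim (↑) c s = b i := by
    intro i
    rcases hb i with h | ⟨j, hj⟩
    · exact ⟨Sum.inl ⟨b i, h⟩, rfl⟩
    · exact ⟨Sum.inr j, hj⟩
  choose s hs using hb'
  let φ' : L.Formula (B ⊕ (Fin n ⊕ Fin k)) :=
    φ.relabel (Sum.elim (fun i => Sum.inr (Sum.inr i))
      fun i => Sum.elim Sum.inl (fun j => Sum.inr (Sum.inl j)) (s i))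
  have key : ∀ z : Fin k → C, Sum.elim c z ∈ {v : Fin n ⊕ Fin k → C |
      φ'.Realize (Sum.elim (fun a : B => (a : C)) v)} ↔ φ.Realize (Sum.elim z b) := by
    intro z
    simp only [mem_ofPred_eq, φ', Formula.realize_relabel]
    refine iff_of_eq (congrArg _ ?_)
    funext i
    rcases i with i | i
    · rfl
    · rw [Sum.elim_inr, ← hs i]
      simp only [Function.comp, Sum.elim_inr]
      rcases s i with j | j <;> rfl
  obtain ⟨z, hz, hzY⟩ := h k _ (definable_iff_exists_formula_sum.2 ⟨φ', rfl⟩)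
    ⟨x, hxP, (key x).2 hx⟩
  exact ⟨z, (key z).1 hzY, hz⟩

theorem mk_definable_le {μ : Cardinal.{u}} (h0 : ℵ₀ ≤ μ) (hL : L.card ≤ μ) {B : Set C}
    (hB : #B ≤ μ) (n j : ℕ) : #{Y : Set (Fin n ⊕ Fin j → C) // B.Definable L Y} ≤ μ := by
  have hα : #(B ⊕ (Fin n ⊕ Fin j)) ≤ μ := by
    rw [Cardinal.mk_sum, Cardinal.lift_uzero]
    refine Cardinal.add_le_of_le h0 hB ?_
    exact (Cardinal.lift_lt_aleph0.2 (Cardinal.lt_aleph0_of_finite _)).le.trans h0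
  refine le_trans ?_ (mk_formula_le h0 hL hα)
  have : ∀ Y : {Y : Set (Fin n ⊕ Fin j → C) // B.Definable L Y}, ∃ φ : L.Formula (B ⊕ (Fin n ⊕ Fin j)),
      Y.1 = {v | φ.Realize (Sum.elim (↑) v)} := fun Y => definable_iff_exists_formula_sum.1 Y.2
  choose f hf using this
  refine Cardinal.mk_le_of_injective (f := f) fun Y Y' h => Subtype.ext ?_
  rw [hf, hf, h]

/-- A notion of consistency for sets of `B`-definable sets that always allows splitting by `ψ` and
finding witnesses in `P` gives more types than stability allows. -/
theorem false_of_splitting [Nonempty C] {T : L.Theory} {κ μ : Cardinal.{u}}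
    (hC : IsMonster κ T C) (hμ : ℵ₀ < μ) (hpow : μ ^< μ = μ) (hLμ : theoryCard L < μ) (hμκ : μ < κ)
    (P : L.Relations 1) {B : Set C} (hB : #B ≤ μ) {n m : ℕ}
    (hcount : #(Σ n : ℕ, StarTypes P B n) ≤ #B ^ theoryCard L)
    (ψ : L.Formula (Fin n ⊕ Fin m)) (Good : Set (Set (Fin n → C)) → Prop)
    (hmono : ∀ r s : Set (Set (Fin n → C)), r ⊆ s → Good s → Good r)
    (hfin : ∀ r : Set (Set (Fin n → C)), (∀ s : Finset (Set (Fin n → C)), ↑s ⊆ r → Good ↑s) →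
      Good r)
    (h0 : Good ∅) (hfip : ∀ r, Good r → FIP r)
    (hsplit : ∀ r : Set (Set (Fin n → C)), #r < μ → Good r → (∀ S ∈ r, B.Definable L S) →
      ∃ a : Fin m → C, (∀ i, a i ∈ B) ∧ Good (insert {x | ψ.Realize (Sum.elim x a)} r) ∧
        Good (insert {x | ψ.Realize (Sum.elim x a)}ᶜ r))
    (htask : ∀ r : Set (Set (Fin n → C)), #r < μ → Good r → (∀ S ∈ r, B.Definable L S) →
      ∀ (j : ℕ) (Y : Set (Fin n ⊕ Fin j → C)), B.Definable L Y →
        Good (insert {x | ¬∃ z : Fin j → C, (∀ i, z i ∈ PPart C P) ∧ Sum.elim x z ∈ Y} r) ∨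
        ∃ b : Fin j → C, (∀ i, b i ∈ PPart C P ∩ B) ∧ Good (insert {x | Sum.elim x b ∈ Y} r)) :
    False := by
  classical
  have hreg := isRegular_of_powerlt_self hμ.le hpow
  have hL : L.card ≤ μ := (le_max_right _ _).trans hLμ.le
  let I := μ.ord.ToType
  let Task := Σ j : ULift.{u} ℕ, {Y : Set (Fin n ⊕ Fin j.down → C) // B.Definable L Y}
  obtain ⟨g, hg⟩ : ∃ g : I → Task, Function.Surjective g := by
    have : Nonempty Task := ⟨⟨⟨0⟩, ⟨∅, definable_empty⟩⟩⟩
    have hT : #Task ≤ #I := by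
      rw [Cardinal.mk_sigma]
      refine (Cardinal.sum_le_sum _ (fun _ => μ) fun k => mk_definable_le hμ.le hL hB _ _).trans ?_
      rw [Cardinal.sum_const', Cardinal.mk_uLift]
      simpa [I] using Cardinal.mul_le_of_le hμ.le hμ.le le_rfl
    obtain ⟨⟨g, hg⟩⟩ := hT
    exact ⟨Function.invFun g, Function.invFun_surjective hg⟩
  -- `W τ` is the condition that requirement `τ` is met; a point in all these sets has its type in
  -- `S_*(B)`.
  let W : Task → Set (Fin n → C) := fun τ =>
    {x | (∃ z : Fin τ.1.down → C, (∀ i, z i ∈ PPart C P) ∧ Sum.elim x z ∈ τ.2.1) →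
      ∃ z : Fin τ.1.down → C, (∀ i, z i ∈ PPart C P ∩ B) ∧ Sum.elim x z ∈ τ.2.1}
  let Good' : Set (Set (Fin n → C)) → Prop := fun r => Good r ∧ ∀ S ∈ r, B.Definable L S
  have hψ : ∀ a : Fin m → C, (∀ i, a i ∈ B) →
      B.Definable L {x : Fin n → C | ψ.Realize (Sum.elim x a)} := fun a ha =>
    definable_fiber (definable_ofPred ψ B) a ha
  have hwit : ∀ (i : I) (r : Set (Set (Fin n → C))), #r < μ → Good' r →
      ∃ S, Good' (insert S r) ∧ S ⊆ W (g i) := by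
    intro i r hr hgood
    have hYneg : B.Definable L {x : Fin n → C | ¬∃ z : Fin (g i).1.down → C,
        (∀ i, z i ∈ PPart C P) ∧ Sum.elim x z ∈ (g i).2.1} :=
      (((definable_pPart P B _ Sum.inr).inter (g i).2.2).exists_of_finite).compl
    rcases htask r hr hgood.1 hgood.2 (g i).1.down (g i).2.1 (g i).2.2 with h | ⟨b, hb, h⟩
    · refine ⟨_, ⟨h, ?_⟩, ?_⟩
      · rintro S (rfl | hS)
        · exact hYneg
        · exact hgood.2 S hS
      · intro x hx hx'
        exact absurd hx' hx
    · refine ⟨_, ⟨h, ?_⟩, ?_⟩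
      · rintro S (rfl | hS)
        · exact definable_fiber (g i).2.2 b fun i => (hb i).2
        · exact hgood.2 S hS
      · intro x hx _
        exact ⟨b, hb, hx⟩
  -- At each node both successors use the same `a`, and each then meets requirement `g i`. Where `r`
  -- is too large or not good the value `∅` is a dummy.
  have hstep : ∀ (i : I) (r : Set (Set (Fin n → C))), ∃ t : Bool → Set (Set (Fin n → C)),
      #r < μ → Good' r → (∀ ε, (t ε).Finite ∧ Good' (r ∪ t ε) ∧ ∃ S ∈ t ε, S ⊆ W (g i)) ∧
        ∃ a : Fin m → C, (∀ i, a i ∈ B) ∧ {x | ψ.Realize (Sum.elim x a)} ∈ t true ∧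
          {x | ψ.Realize (Sum.elim x a)}ᶜ ∈ t false := by
    intro i r
    by_cases hr : #r < μ ∧ Good' r
    swap
    · exact ⟨fun _ => ∅, fun h h' => absurd ⟨h, h'⟩ hr⟩
    obtain ⟨hr, hgood⟩ := hr
    obtain ⟨a, ha, h1, h2⟩ := hsplit r hr hgood.1 hgood.2
    have hins : ∀ S, #(insert S r : Set (Set (Fin n → C))) < μ := fun S =>
      (Cardinal.mk_insert_le).trans_lt
        (Cardinal.add_lt_of_lt hμ.le hr (Cardinal.one_lt_aleph0.trans hμ))
    have hG : ∀ S, B.Definable L S → Good (insert S r) → Good' (insert S r) := by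
      intro S hS h
      refine ⟨h, ?_⟩
      rintro S' (rfl | h')
      · exact hS
      · exact hgood.2 S' h'
    obtain ⟨S1, hS1, hW1⟩ := hwit i _ (hins _) (hG _ (hψ a ha) h1)
    obtain ⟨S2, hS2, hW2⟩ := hwit i _ (hins _) (hG _ (hψ a ha).compl h2)
    refine ⟨fun ε => if ε then {{x | ψ.Realize (Sum.elim x a)}, S1}
      else {{x | ψ.Realize (Sum.elim x a)}ᶜ, S2}, fun _ _ => ⟨?_, a, ha, by simp, by simp⟩⟩
    rintro (_ | _)
    · refine ⟨by simp, ?_, S2, by simp, hW2⟩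
      convert hS2 using 1
      ext S; simp only [mem_union, mem_insert_iff]; simp; tauto
    · refine ⟨by simp, ?_, S1, by simp, hW1⟩
      convert hS1 using 1
      ext S; simp only [mem_union, mem_insert_iff]; simp; tauto
  choose t ht using hstep
  have hall : ∀ η : I → Bool,
      (∀ i, #(stages (fun i r => t i r (η i)) i) < μ ∧ Good' (stages (fun i r => t i r (η i)) i)) ∧
      Good' (⋃ i, t i (stages (fun i r => t i r (η i)) i) (η i)) := by
    intro η
    refine stages_good hreg Good' (fun r s hrs h => ⟨hmono r s hrs h.1, fun S hS => h.2 S (hrs hS)⟩)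
      (fun r h => ⟨hfin r fun s hs => (h s hs).1, fun S hS => (h {S} (by simpa)).2 S (by simp)⟩)
      ⟨h0, by simp⟩ (fun i r => t i r (η i)) ?_ ?_
    · intro i r hr h
      have := (((ht i r hr h).1 (η i)).1)
      exact (Cardinal.lt_aleph0_iff_set_finite.2 this).trans hμ
    · intro i r hr h
      exact ((ht i r hr h).1 (η i)).2.1
  have hreal : ∀ η : I → Bool, ∃ c : Fin n → C, ∀ i,
      ∀ S ∈ t i (stages (fun i r => t i r (η i)) i) (η i), c ∈ S := by
    intro η
    obtain ⟨c, hc⟩ := hC.nonempty_sInter (hB.trans_lt hμκ) (hall η).2.2 (hfip _ (hall η).2.1)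
    exact ⟨c, fun i S hS => mem_sInter.1 hc S (mem_iUnion.2 ⟨i, hS⟩)⟩
  choose c hc using hreal
  have hstar : ∀ η, tp B (c η) ∈ StarTypes P B n := by
    intro η
    refine (mem_starTypes_iff (L := L)).2 ⟨c η, rfl, isStarComplete_of_witnesses fun j Y hY h => ?_⟩
    obtain ⟨i, hi⟩ := hg ⟨⟨j⟩, ⟨Y, hY⟩⟩
    have hi' := (hall η).1 i
    obtain ⟨S, hS, hSW⟩ := ((ht i _ hi'.1 hi'.2).1 (η i)).2.2
    have := hSW (hc η i S hS)
    rw [hi] at this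
    exact this h
  have hinj : Function.Injective fun η => (⟨n, ⟨tp B (c η), hstar η⟩⟩ : Σ n : ℕ, StarTypes P B n) := by
    intro η η' h
    by_contra hne
    have h' : (tp B (c η) : TypeOver L B n) = tp B (c η') := by simpa using h
    have hex : {i | η i ≠ η' i}.Nonempty := Function.ne_iff.1 hne
    obtain ⟨i, hi, hmin⟩ := (wellFounded_lt (α := I)).has_min _ hex
    -- Below the first difference `i` the branches coincide, so both use the same instance of `ψ` at
    -- `i`, with opposite signs.
    have hst : stages (fun i r => t i r (η i)) i = stages (fun i r => t i r (η' i)) i := by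
      refine stages_congr i fun j hj => ?_
      have : η j = η' j := by
        by_contra hj'
        exact hmin j hj' hj
      rw [this]
    have hi' := (hall η).1 i
    obtain ⟨a, ha, h1, h2⟩ := (ht i _ hi'.1 hi'.2).2
    have e1 := hc η i
    have e2 := hc η' i
    rw [← hst] at e2
    have hiff : ψ.Realize (Sum.elim (c η) a) ↔ ψ.Realize (Sum.elim (c η') a) := by
      have k1 := memType_tp ψ (fun i => (⟨a i, ha i⟩ : B)) (c η)
      have k2 := memType_tp ψ (fun i => (⟨a i, ha i⟩ : B)) (c η')
      rw [h'] at k1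
      exact k1.symm.trans k2
    have hi2 : η i ≠ η' i := hi
    rcases hη : η i with _ | _ <;> rcases hη' : η' i with _ | _ <;> rw [hη, hη'] at hi2 <;>
      rw [hη] at e1 <;> rw [hη'] at e2
    · exact hi2 rfl
    · exact e1 _ h2 (hiff.2 (e2 _ h1))
    · exact e2 _ h2 (hiff.1 (e1 _ h1))
    · exact hi2 rfl
  have h1 : (2 : Cardinal.{u}) ^ μ ≤ #(Σ n : ℕ, StarTypes P B n) := by
    have := Cardinal.mk_le_of_injective hinj
    simpa [I] using this
  -- `|B|^{|T|} ≤ μ^{<μ} = μ`, against `2^μ` distinct types.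
  have h2 : #B ^ theoryCard L ≤ μ :=
    (Cardinal.power_le_power_right hB).trans ((Cardinal.le_powerlt μ hLμ).trans hpow.le)
  exact absurd (h1.trans (hcount.trans h2)) (not_le.2 (Cardinal.cantor μ))

end

/-! ### Cardinalities of sets of formulas; finite intersections -/

section Cardinality

variable {L : FirstOrder.Language.{u, u}}

theorem mk_formula_le_theoryCard {α : Type} [Finite α] : #(L.Formula α) ≤ theoryCard L := by
  have h1 : #(L.Formula α) ≤ #(Σ n, L.BoundedFormula α n) :=
    Cardinal.mk_le_of_injective (f := fun φ => ⟨0, φ⟩) fun φ ψ h => by simpa using h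
  have h0 : ℵ₀ ≤ theoryCard L := le_max_left _ _
  refine h1.trans (BoundedFormula.card_le.trans (max_le h0 ?_))
  refine Cardinal.add_le_of_le h0 ?_ ?_
  · exact (Cardinal.lift_lt_aleph0.2 (Cardinal.lt_aleph0_of_finite _)).le.trans h0
  · rw [Cardinal.lift_uzero]
    exact le_max_right _ _

theorem mk_sigma_nat_le {μ : Cardinal.{u}} (h0 : ℵ₀ ≤ μ) {f : ℕ → Type u} (hf : ∀ k, #(f k) ≤ μ) :
    #(Σ k, f k) ≤ μ := by
  have e : (Σ k, f k) ≃ Σ k : ULift.{u} ℕ, f k.down :=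
    ⟨fun p => ⟨⟨p.1⟩, p.2⟩, fun p => ⟨p.1.down, p.2⟩, fun _ => rfl, fun _ => rfl⟩
  rw [Cardinal.mk_congr e, Cardinal.mk_sigma]
  refine (Cardinal.sum_le_sum _ (fun _ => μ) fun k => hf _).trans ?_
  rw [Cardinal.sum_const', Cardinal.mk_uLift]
  simpa using Cardinal.mul_le_of_le h0 h0 le_rfl

theorem mk_finset_lt {μ : Cardinal.{u}} (hμ : ℵ₀ < μ) {X : Type u} (hX : #X < μ) :
    #(Finset X) < μ := by
  rcases finite_or_infinite X with h | h
  · exact (Cardinal.lt_aleph0_of_finite _).trans hμ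
  · rwa [Cardinal.mk_finset_of_infinite]

end Cardinality

section SubInter

variable {X : Type u}

/-- The intersection of finitely many members of a family of sets. -/
def subInter (r : Set (Set X)) (s : Finset r) : Set X :=
  ⋂₀ (↑(s.map (Function.Embedding.subtype _)) : Set (Set X))

theorem subInter_union_left [DecidableEq (Set X)] (r : Set (Set X)) (s s' : Finset r) :
    subInter r (s ∪ s') ⊆ subInter r s :=
  sInter_subset_sInter
    (Finset.coe_subset.2 (Finset.map_subset_map.2 Finset.subset_union_left))

theorem subInter_union_right [DecidableEq (Set X)] (r : Set (Set X)) (s s' : Finset r) :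
    subInter r (s ∪ s') ⊆ subInter r s' :=
  sInter_subset_sInter
    (Finset.coe_subset.2 (Finset.map_subset_map.2 Finset.subset_union_right))

theorem exists_subInter_eq {r : Set (Set X)} {s : Finset (Set X)} (hs : ↑s ⊆ r) :
    ∃ s₁ : Finset r, subInter r s₁ = ⋂₀ ↑s := by
  classical
  refine ⟨s.subtype (· ∈ r), ?_⟩
  rw [subInter, Finset.subtype_map_of_mem fun x hx => hs hx]

theorem FIP.nonempty_subInter {r : Set (Set X)} (h : FIP r) (s : Finset r) :
    (subInter r s).Nonempty :=
  h _ (Finset.map_subtype_subset s)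

theorem exists_subset_of_subset_insert {s' : Finset (Set X)} {S : Set X} {r : Set (Set X)}
    (hs' : (↑s' : Set (Set X)) ⊆ insert S r) : ∃ s : Finset (Set X), ↑s ⊆ r ∧
      ⋂₀ (↑s : Set (Set X)) ∩ S ⊆ ⋂₀ ↑s' := by
  classical
  refine ⟨s'.filter (· ≠ S), fun S' hS' => ?_, fun x hx => mem_sInter.2 fun S' hS' => ?_⟩
  · obtain ⟨h1, h2⟩ := Finset.mem_filter.1 (Finset.mem_coe.1 hS')
    exact (hs' h1).resolve_left h2
  · by_cases h : S' = S
    · exact h ▸ hx.2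
    · exact mem_sInter.1 hx.1 S' (by simpa using ⟨hS', h⟩)

theorem FIP_insert_iff {r : Set (Set X)} {S : Set X} :
    FIP (insert S r) ↔ ∀ s : Finset r, (subInter r s ∩ S).Nonempty := by
  classical
  constructor
  · intro h s
    obtain ⟨x, hx⟩ := h (insert S (s.map (Function.Embedding.subtype _))) (by
      rw [Finset.coe_insert]
      exact insert_subset_insert (Finset.map_subtype_subset s))
    rw [Finset.coe_insert, sInter_insert] at hx
    exact ⟨x, hx.2, hx.1⟩
  · intro h s' hs'
    obtain ⟨s, hs, hsub⟩ := exists_subset_of_subset_insert hs'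
    obtain ⟨s₁, hs₁⟩ := exists_subInter_eq hs
    exact (hs₁ ▸ h s₁).mono hsub

theorem definable_subInter {L : FirstOrder.Language.{u, u}} {C : Type u} [L.Structure C] {n : ℕ}
    {D : Set C} {r : Set (Set (Fin n → C))} (hr : ∀ S ∈ r, D.Definable L S) (s : Finset r) :
    D.Definable L (subInter r s) :=
  definable_sInter _ fun S hS => hr S (Finset.map_subtype_subset s (Finset.mem_coe.2 hS))

end SubInter

/-! ### The rank -/

section Rank

variable {L : FirstOrder.Language.{u, u}} {C : Type u} [L.Structure C]

/-- A formula `χ(x, d, z)`, to be witnessed by a tuple `z` of `P^C`. -/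
abbrev Task (L : FirstOrder.Language.{u, u}) (n : ℕ) : Type u :=
  Σ l j : ℕ, L.Formula ((Fin n ⊕ Fin l) ⊕ Fin j)

theorem mk_task_le (n : ℕ) : #(Task L n) ≤ theoryCard L :=
  mk_sigma_nat_le (le_max_left _ _) fun _ => mk_sigma_nat_le (le_max_left _ _) fun _ =>
    mk_formula_le_theoryCard

/-- The set of all `x` for which `χ(x, d, z)` has no solution `z` in `P^C`. -/
def taskNeg (P : L.Relations 1) {n : ℕ} (τ : Task L n) (d : Fin τ.1 → C) : Set (Fin n → C) :=
  {x | ¬∃ z : Fin τ.2.1 → C, (∀ i, z i ∈ PPart C P) ∧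
    τ.2.2.Realize (Sum.elim (Sum.elim x d) z)}

/-- The set defined by `χ(x, d, b)`. -/
def taskPos {n : ℕ} (τ : Task L n) (d : Fin τ.1 → C) (b : Fin τ.2.1 → C) : Set (Fin n → C) :=
  {x | τ.2.2.Realize (Sum.elim (Sum.elim x d) b)}

/-- The set `S` has rank at least `k`: steps that split `S` by an instance of `ψ` alternate with
steps that choose witnesses in `P^C` for the formulas in `Δ`. -/
def HasRank (P : L.Relations 1) {n m : ℕ} (ψ : L.Formula (Fin n ⊕ Fin m)) (Δ : Finset (Task L n)) :
    ℕ → Set (Fin n → C) → Prop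
  | 0, S => S.Nonempty
  | k + 1, S => (∃ a : Fin m → C, HasRank P ψ Δ k (S ∩ {x | ψ.Realize (Sum.elim x a)}) ∧
      HasRank P ψ Δ k (S ∩ {x | ψ.Realize (Sum.elim x a)}ᶜ)) ∧
      ∀ τ ∈ Δ, ∀ d : Fin τ.1 → C, HasRank P ψ Δ k (S ∩ taskNeg P τ d) ∨
        ∃ b : Fin τ.2.1 → C, (∀ i, b i ∈ PPart C P) ∧ HasRank P ψ Δ k (S ∩ taskPos τ d b)

variable {P : L.Relations 1} {n m : ℕ} {ψ : L.Formula (Fin n ⊕ Fin m)} {Δ Δ' : Finset (Task L n)}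

theorem HasRank.mono {k : ℕ} {S S' : Set (Fin n → C)} (h : HasRank P ψ Δ k S) (hS : S ⊆ S') :
    HasRank P ψ Δ k S' := by
  induction k generalizing S S' with
  | zero => exact Set.Nonempty.mono hS h
  | succ k ih =>
    obtain ⟨⟨a, h1, h2⟩, h3⟩ := h
    refine ⟨⟨a, ih h1 (inter_subset_inter_left _ hS), ih h2 (inter_subset_inter_left _ hS)⟩,
      fun τ hτ d => ?_⟩
    rcases h3 τ hτ d with h | ⟨b, hb, h⟩
    · exact Or.inl (ih h (inter_subset_inter_left _ hS))
    · exact Or.inr ⟨b, hb, ih h (inter_subset_inter_left _ hS)⟩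

theorem HasRank.anti {k : ℕ} {S : Set (Fin n → C)} (h : HasRank P ψ Δ' k S) (hΔ : Δ ⊆ Δ') :
    HasRank P ψ Δ k S := by
  induction k generalizing S with
  | zero => exact h
  | succ k ih =>
    obtain ⟨⟨a, h1, h2⟩, h3⟩ := h
    refine ⟨⟨a, ih h1, ih h2⟩, fun τ hτ d => ?_⟩
    rcases h3 τ (hΔ hτ) d with h | ⟨b, hb, h⟩
    · exact Or.inl (ih h)
    · exact Or.inr ⟨b, hb, ih h⟩

theorem HasRank.le {k k' : ℕ} {S : Set (Fin n → C)} (h : HasRank P ψ Δ k' S) (hk : k ≤ k') :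
    HasRank P ψ Δ k S := by
  induction k', hk using Nat.le_induction with
  | base => exact h
  | succ k' _ ih =>
    obtain ⟨⟨a, h1, -⟩, -⟩ := h
    exact ih (h1.mono inter_subset_left)

theorem definable_taskNeg (τ : Task L n) (D : Set C) :
    D.Definable L {v : Fin n ⊕ Fin τ.1 → C | v ∘ Sum.inl ∈ taskNeg P τ (v ∘ Sum.inr)} := by
  have := ((definable_pPart (α := (Fin n ⊕ Fin τ.1) ⊕ Fin τ.2.1) P D _ Sum.inr).inter
    (definable_ofPred τ.2.2 D)).exists_of_finite.compl
  convert this using 1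
  ext v
  simp [taskNeg]

theorem definable_taskPos (τ : Task L n) (D : Set C) :
    D.Definable L {v : (Fin n ⊕ Fin τ.1) ⊕ Fin τ.2.1 → C |
      v ∘ Sum.inl ∘ Sum.inl ∈ taskPos τ (v ∘ Sum.inl ∘ Sum.inr) (v ∘ Sum.inr)} := by
  convert definable_ofPred τ.2.2 D using 1
  ext v
  simp only [taskPos, mem_ofPred_eq]
  refine iff_of_eq (congrArg _ ?_)
  funext i
  rcases i with (i | i) | i <;> rfl

/-- The rank of the members of a definable family is definable. -/
theorem definable_hasRank (P : L.Relations 1) (ψ : L.Formula (Fin n ⊕ Fin m))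
    (Δ : Finset (Task L n)) (k : ℕ) {α : Type} {D : Set C} {S : Set (α ⊕ Fin n → C)}
    (hS : D.Definable L S) :
    D.Definable L {w : α → C | HasRank P ψ Δ k {x | Sum.elim w x ∈ S}} := by
  -- Each step adds the tuples `a`, `d` or `b` to the parameters of the family, so `α` has to vary.
  induction k generalizing α with
  | zero => exact hS.exists_of_finite
  | succ k ih =>
    have hsplit : ∀ Ψ : Set (Fin n ⊕ Fin m → C), D.Definable L Ψ → D.Definable L
        {w : α ⊕ Fin m → C | HasRank P ψ Δ k ({x | Sum.elim (w ∘ Sum.inl) x ∈ S} ∩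
          {x | Sum.elim x (w ∘ Sum.inr) ∈ Ψ})} := by
      intro Ψ hΨ
      convert ih (α := α ⊕ Fin m) ((hS.preimage_comp (β := (α ⊕ Fin m) ⊕ Fin n)
        (Sum.elim (Sum.inl ∘ Sum.inl) Sum.inr)).inter
        (hΨ.preimage_comp (Sum.elim Sum.inr (Sum.inl ∘ Sum.inr)))) using 1
      ext w
      simp only [mem_ofPred_eq, mem_inter_iff, mem_preimage, Sum.comp_elim, Sum.elim_comp_inr,
        ← Function.comp_assoc, Sum.elim_comp_inl]
      rfl
    have h1 := ((hsplit _ (definable_ofPred ψ D)).inter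
      (hsplit _ (definable_ofPred ψ D).compl)).exists_of_finite
    have h2 : ∀ τ : Task L n, D.Definable L {w : α → C | ∀ d : Fin τ.1 → C,
        HasRank P ψ Δ k ({x | Sum.elim w x ∈ S} ∩ taskNeg P τ d) ∨
        ∃ b : Fin τ.2.1 → C, (∀ i, b i ∈ PPart C P) ∧
          HasRank P ψ Δ k ({x | Sum.elim w x ∈ S} ∩ taskPos τ d b)} := by
      intro τ
      have hneg := ih (α := α ⊕ Fin τ.1) ((hS.preimage_comp (β := (α ⊕ Fin τ.1) ⊕ Fin n)
        (Sum.elim (Sum.inl ∘ Sum.inl) Sum.inr)).inter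
        ((definable_taskNeg (P := P) τ D).preimage_comp (Sum.elim Sum.inr (Sum.inl ∘ Sum.inr))))
      have hpos := ih (α := (α ⊕ Fin τ.1) ⊕ Fin τ.2.1)
        ((hS.preimage_comp (β := ((α ⊕ Fin τ.1) ⊕ Fin τ.2.1) ⊕ Fin n)
        (Sum.elim (Sum.inl ∘ Sum.inl ∘ Sum.inl) Sum.inr)).inter
        ((definable_taskPos τ D).preimage_comp
          (Sum.elim (Sum.elim Sum.inr (Sum.inl ∘ Sum.inl ∘ Sum.inr)) (Sum.inl ∘ Sum.inr))))
      convert (hneg.union ((definable_pPart P D _ Sum.inr).inter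
        hpos).exists_of_finite).forall_of_finite using 1
      ext w
      simp only [mem_ofPred_eq, mem_inter_iff, mem_union, mem_preimage, Sum.comp_elim,
        Sum.elim_comp_inr, ← Function.comp_assoc, Sum.elim_comp_inl, Sum.elim_inr]
      rfl
    convert h1.inter (definable_biInter_finset h2 Δ) using 1
    ext w
    simp only [mem_inter_iff, mem_iInter]
    rfl

end Rank

/-! ### Finiteness of the rank -/

section

variable {L : FirstOrder.Language.{u, u}} {C : Type u} [L.Structure C]

theorem exists_mem_of_definable (M : L.ElementarySubstructure C) {k : ℕ} {S : Set (Fin k → C)}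
    (hS : (M : Set C).Definable L S) (hne : S.Nonempty) : ∃ x ∈ S, ∀ i, x i ∈ (M : Set C) := by
  obtain ⟨m, φ, b, hb⟩ := exists_formula_of_definable hS
  let χ : L.Formula (Fin m) := (φ.relabel Sum.swap : L.Formula (Fin m ⊕ Fin k)).iExs (Fin k)
  have h1 : χ.Realize fun i => ((b i : M) : C) := by
    obtain ⟨x, hx⟩ := hne
    simp only [χ]
    rw [Formula.realize_iExs]
    refine ⟨x, ?_⟩
    rw [Formula.realize_relabel]
    convert (hb x).1 hx using 1
    funext i
    rcases i with i | i <;> rfl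
  have h2 : χ.Realize (M := M) b := (M.subtype.map_formula χ b).1 h1
  simp only [χ] at h2
  rw [Formula.realize_iExs] at h2
  obtain ⟨x, hx⟩ := h2
  refine ⟨fun i => x i, (hb _).2 ?_, fun i => (x i).2⟩
  rw [Formula.realize_relabel, ← M.subtype.map_formula] at hx
  convert hx using 1
  funext i
  rcases i with i | i <;> rfl

/-- If all small models of `T` are stable over `P`, all ranks are finite. -/
theorem exists_not_hasRank [L.IsRelational] [Nonempty C] {T : L.Theory} {κ μ : Cardinal.{u}}
    (hC : IsMonster κ T C) (hμ : ℵ₀ < μ) (hpow : μ ^< μ = μ) (hLμ : theoryCard L < μ) (hμκ : μ < κ)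
    (P : L.Relations 1) (M : L.ElementarySubstructure C) (hM : #M ≤ μ)
    (hcomp : IsCompactIn L μ (M : Set C) M) (hst : IsStableSet κ P (M : Set C)) {n m : ℕ}
    (ψ : L.Formula (Fin n ⊕ Fin m)) :
    ∃ (Δ : Finset (Task L n)) (k : ℕ), ¬HasRank P ψ Δ k (univ : Set (Fin n → C)) := by
  classical
  by_contra hrank
  push Not at hrank
  -- A family counts as consistent if its finite intersections have all finite ranks for all finite
  -- `Δ`. Rank `k + 1` provides splittings and witnesses that leave rank `k`, and compactness of `M`
  -- makes one choice work for all `Δ`, `k` and finite intersections.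
  let Good : Set (Set (Fin n → C)) → Prop := fun r =>
    ∀ s : Finset (Set (Fin n → C)), ↑s ⊆ r → ∀ Δ k, HasRank P ψ Δ k (⋂₀ (↑s : Set (Set (Fin n → C))))
  have hins : ∀ r S, (∀ s : Finset (Set (Fin n → C)), ↑s ⊆ r →
      ∀ Δ k, HasRank P ψ Δ k (⋂₀ (↑s : Set (Set (Fin n → C))) ∩ S)) → Good (insert S r) := by
    intro r S h s' hs' Δ k
    obtain ⟨s, hs, hsub⟩ := exists_subset_of_subset_insert hs'
    exact (h s hs Δ k).mono hsub
  -- the sets of intersections, tasks and ranks that have to be considered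
  let ι : Set (Set (Fin n → C)) → Type u := fun r => Finset r × Finset (Task L n) × ULift.{u} ℕ
  have hι : ∀ r : Set (Set (Fin n → C)), #r < μ → #(ι r) < μ := by
    intro r hr
    simp only [ι, Cardinal.mk_prod, Cardinal.lift_id, Cardinal.mk_uLift, Cardinal.mk_nat,
      Cardinal.lift_aleph0]
    exact Cardinal.mul_lt_of_lt hμ.le (mk_finset_lt hμ hr)
      (Cardinal.mul_lt_of_lt hμ.le (mk_finset_lt hμ ((mk_task_le n).trans_lt hLμ)) hμ)
  have hcount : #(Σ n : ℕ, StarTypes P (M : Set C) n) ≤ #(M : Set C) ^ theoryCard L :=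
    hst.2 M (lt_of_le_of_lt hM hμκ) rfl
  refine false_of_splitting hC hμ hpow hLμ hμκ P (B := M) hM hcount ψ Good
    (fun r s hrs h t ht => h t (ht.trans hrs)) (fun r h s hs => h s hs s subset_rfl)
    (fun s hs Δ k => by
      have : s = ∅ := by simpa using hs
      subst this
      simpa using hrank Δ k) (fun r h s hs => h s hs ∅ 0) ?_ ?_
  · intro r hr hgood hdef
    let V : ι r → Set (Fin m → C) := fun i => {a |
      HasRank P ψ i.2.1 i.2.2.down (subInter r i.1 ∩ {x | ψ.Realize (Sum.elim x a)}) ∧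
      HasRank P ψ i.2.1 i.2.2.down (subInter r i.1 ∩ {x | ψ.Realize (Sum.elim x a)}ᶜ)}
    have hV : ∀ i, (M : Set C).Definable L (V i) := by
      intro i
      have h1 : ∀ Ψ : Set (Fin n ⊕ Fin m → C), (M : Set C).Definable L Ψ → (M : Set C).Definable L
          {a | HasRank P ψ i.2.1 i.2.2.down (subInter r i.1 ∩ {x | Sum.elim x a ∈ Ψ})} := by
        intro Ψ hΨ
        convert definable_hasRank P ψ i.2.1 i.2.2.down (α := Fin m)
          (((definable_subInter hdef i.1).preimage_comp (β := Fin m ⊕ Fin n) Sum.inr).inter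
            (hΨ.preimage_comp Sum.swap)) using 1
        ext a
        simp only [mem_ofPred_eq, mem_inter_iff, mem_preimage, Sum.elim_comp_inr, Sum.elim_swap]
        rfl
      exact (h1 _ (definable_ofPred ψ _)).inter (h1 _ (definable_ofPred ψ _).compl)
    obtain ⟨a, ha, haM⟩ := hcomp.exists_of_directed (hι r hr) V hV (by
      intro i j
      refine ⟨⟨i.1 ∪ j.1, i.2.1 ∪ j.2.1, ⟨max i.2.2.down j.2.2.down⟩⟩, ?_, ?_⟩
      · intro a ha
        exact ⟨((ha.1.mono (inter_subset_inter_left _ (subInter_union_left r _ _))).anti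
            Finset.subset_union_left).le (le_max_left _ _),
          ((ha.2.mono (inter_subset_inter_left _ (subInter_union_left r _ _))).anti
            Finset.subset_union_left).le (le_max_left _ _)⟩
      · intro a ha
        exact ⟨((ha.1.mono (inter_subset_inter_left _ (subInter_union_right r _ _))).anti
            Finset.subset_union_right).le (le_max_right _ _),
          ((ha.2.mono (inter_subset_inter_left _ (subInter_union_right r _ _))).anti
            Finset.subset_union_right).le (le_max_right _ _)⟩) (by
      intro i
      refine exists_mem_of_definable M (hV i) ?_
      obtain ⟨a, ha⟩ := (hgood _ (Finset.map_subtype_subset i.1) i.2.1 (i.2.2.down + 1)).1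
      exact ⟨a, ha⟩)
    refine ⟨a, haM, hins _ _ fun s hs Δ k => ?_, hins _ _ fun s hs Δ k => ?_⟩
    · obtain ⟨s₁, hs₁⟩ := exists_subInter_eq hs
      rw [← hs₁]
      exact (ha ⟨s₁, Δ, ⟨k⟩⟩).1
    · obtain ⟨s₁, hs₁⟩ := exists_subInter_eq hs
      rw [← hs₁]
      exact (ha ⟨s₁, Δ, ⟨k⟩⟩).2
  · intro r hr hgood hdef j Y hY
    obtain ⟨l, χ, d, hd, rfl⟩ := definable_iff_fiber.1 hY
    let τ : Task L n := ⟨l, j, χ.relabel (Sum.elim (Sum.elim (fun i => Sum.inl (Sum.inl i)) Sum.inr)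
      fun i => Sum.inl (Sum.inr i))⟩
    have hτ : ∀ (x : Fin n → C) (z : Fin j → C), Sum.elim x z ∈ {v : Fin n ⊕ Fin j → C |
        χ.Realize (Sum.elim v d)} ↔ τ.2.2.Realize (Sum.elim (Sum.elim x d) z) := by
      intro x z
      simp only [τ, mem_ofPred_eq, Formula.realize_relabel]
      refine iff_of_eq (congrArg _ ?_)
      funext i
      rcases i with (i | i) | i <;> rfl
    have hneg : {x : Fin n → C | ¬∃ z : Fin j → C, (∀ i, z i ∈ PPart C P) ∧
        Sum.elim x z ∈ {v : Fin n ⊕ Fin j → C | χ.Realize (Sum.elim v d)}} = taskNeg P τ d := by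
      ext x
      simp only [taskNeg, hτ]
      rfl
    have hpos : ∀ b : Fin j → C, {x : Fin n → C | Sum.elim x b ∈
        {v : Fin n ⊕ Fin j → C | χ.Realize (Sum.elim v d)}} = taskPos τ d b := by
      intro b
      ext x
      exact hτ x b
    rw [hneg]
    simp only [hpos]
    by_cases hg : Good (insert (taskNeg P τ d) r)
    · exact Or.inl hg
    right
    obtain ⟨s₀, hs₀, Δ₀, k₀, h₀⟩ : ∃ s₀ : Finset (Set (Fin n → C)), ↑s₀ ⊆ r ∧ ∃ Δ₀ k₀,
        ¬HasRank P ψ Δ₀ k₀ (⋂₀ (↑s₀ : Set (Set (Fin n → C))) ∩ taskNeg P τ d) := by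
      by_contra h
      push Not at h
      exact hg (hins _ _ h)
    obtain ⟨t₀, ht₀⟩ := exists_subInter_eq hs₀
    rw [← ht₀] at h₀
    let V : ι r → Set (Fin j → C) := fun i => {b | (∀ i, b i ∈ PPart C P) ∧
      HasRank P ψ i.2.1 i.2.2.down (subInter r i.1 ∩ taskPos τ d b)}
    have hV : ∀ i, (M : Set C).Definable L (V i) := by
      intro i
      change (M : Set C).Definable L ({b : Fin j → C | ∀ i, b i ∈ PPart C P} ∩
        {b | HasRank P ψ i.2.1 i.2.2.down (subInter r i.1 ∩ taskPos τ d b)})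
      refine (definable_pPart P _ _ id).inter ?_
      have h1 := definable_hasRank P ψ i.2.1 i.2.2.down (α := Fin l ⊕ Fin j)
          (((definable_subInter hdef i.1).preimage_comp (β := (Fin l ⊕ Fin j) ⊕ Fin n) Sum.inr).inter
            ((definable_taskPos τ _).preimage_comp
              (Sum.elim (Sum.elim Sum.inr (Sum.inl ∘ Sum.inl)) (Sum.inl ∘ Sum.inr))))
      convert definable_fiber_left h1 d hd using 1
      ext b
      simp only [mem_ofPred_eq, mem_inter_iff, mem_preimage, Sum.comp_elim, Sum.elim_comp_inr,
        ← Function.comp_assoc, Sum.elim_comp_inl]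
      rfl
    obtain ⟨b, hb, hbM⟩ := hcomp.exists_of_directed (hι r hr) V hV (by
      intro i j
      refine ⟨⟨i.1 ∪ j.1, i.2.1 ∪ j.2.1, ⟨max i.2.2.down j.2.2.down⟩⟩, ?_, ?_⟩
      · intro a ha
        exact ⟨ha.1, ((ha.2.mono (inter_subset_inter_left _ (subInter_union_left r _ _))).anti
            Finset.subset_union_left).le (le_max_left _ _)⟩
      · intro a ha
        exact ⟨ha.1, ((ha.2.mono (inter_subset_inter_left _ (subInter_union_right r _ _))).anti
            Finset.subset_union_right).le (le_max_right _ _)⟩) (by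
      intro i
      refine exists_mem_of_definable M (hV i) ?_
      -- The rank is taken large enough that the negative alternative for `τ` would contradict `h₀`,
      -- while a witness still leaves the rank demanded by `i`.
      have h1 := (hgood _ (Finset.map_subtype_subset (i.1 ∪ t₀)) (insert τ (i.2.1 ∪ Δ₀))
        (max i.2.2.down k₀ + 1)).2 τ (Finset.mem_insert_self _ _) d
      rcases h1 with h1 | ⟨b, hb, h1⟩
      · refine absurd ?_ h₀
        exact ((h1.mono (inter_subset_inter_left _ (subInter_union_right r _ _))).anti
          (Finset.subset_union_right.trans (Finset.subset_insert _ _))).le (le_max_right _ _)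
      · exact ⟨b, hb, ((h1.mono (inter_subset_inter_left _ (subInter_union_left r _ _))).anti
          (Finset.subset_union_left.trans (Finset.subset_insert _ _))).le (le_max_left _ _)⟩)
    refine ⟨b, fun i => ⟨(hb ⟨∅, ∅, ⟨0⟩⟩).1 i, hbM i⟩, hins _ _ fun s hs Δ k => ?_⟩
    obtain ⟨s₁, hs₁⟩ := exists_subInter_eq hs
    rw [← hs₁]
    exact (hb ⟨s₁, Δ, ⟨k⟩⟩).2

end

/-! ### Isolated types over a stable base -/

section

variable {L : FirstOrder.Language.{u, u}} {C : Type u} [L.Structure C]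

theorem definable_elim_comp {α β γ : Type*} {D : Set C} {S : Set (α ⊕ β → C)}
    (hS : D.Definable L S) (f : α → γ) (g : β → γ) :
    D.Definable L {v : γ → C | Sum.elim (v ∘ f) (v ∘ g) ∈ S} := by
  convert hS.preimage_comp (Sum.elim f g) using 1
  ext v
  simp only [mem_ofPred_eq, mem_preimage, Sum.comp_elim]

theorem definable_eq_point {α : Type*} {k : ℕ} {D : Set C} (f : Fin k → α) {b : Fin k → C}
    (hb : ∀ i, b i ∈ D) : D.Definable L {v : α → C | v ∘ f = b} := by
  have := definable_fiber (definable_ofPred (L := L) (Formula.iInf fun i : Fin k =>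
    (Term.var (Sum.inl (f i))).equal (Term.var (Sum.inr i)) : L.Formula (α ⊕ Fin k)) D) b hb
  convert this using 1
  ext v
  simp [Formula.realize_iInf, Formula.realize_equal, funext_iff]

/-- The instances `ψ(x, a)`, for `a` in `B`, do not split `S`. -/
def Decides (B : Set C) {n m : ℕ} (ψ : L.Formula (Fin n ⊕ Fin m)) (S : Set (Fin n → C)) : Prop :=
  ∀ a : Fin m → C, (∀ i, a i ∈ B) → (∀ x ∈ S, ψ.Realize (Sum.elim x a)) ∨
    ∀ x ∈ S, ¬ψ.Realize (Sum.elim x a)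

/-- For each formula `ψ`, the type of `e` over `B` for instances of `ψ` is isolated. -/
def IsIsolatedOver (L : FirstOrder.Language.{u, u}) {C : Type u} [L.Structure C] (B : Set C)
    {l : ℕ} (e : Fin l → C) : Prop :=
  ∀ (m : ℕ) (ψ : L.Formula (Fin l ⊕ Fin m)), ∃ S, B.Definable L S ∧ e ∈ S ∧ Decides B ψ S

theorem mk_sigma_formula_le (l : ℕ) : #(Σ m : ℕ, L.Formula (Fin l ⊕ Fin m)) ≤ theoryCard L :=
  mk_sigma_nat_le (le_max_left _ _) fun _ => mk_formula_le_theoryCard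

/-- There are only `|T|` formulas, so isolation is witnessed by fewer than `μ` sets, within reach of
compactness. Any other tuple in all of them is isolated by the same sets. -/
theorem IsIsolatedOver.exists_family {B : Set C} {l : ℕ} {e : Fin l → C}
    (he : IsIsolatedOver L B e) : ∃ r : Set (Set (Fin l → C)), #r ≤ theoryCard L ∧
      (∀ S ∈ r, B.Definable L S) ∧ (∀ S ∈ r, e ∈ S) ∧
      ∀ (m : ℕ) (ψ : L.Formula (Fin l ⊕ Fin m)), ∃ S ∈ r, Decides B ψ S := by
  choose S hS heS hdec using he
  refine ⟨range fun p : Σ m : ℕ, L.Formula (Fin l ⊕ Fin m) => S p.1 p.2,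
    Cardinal.mk_range_le.trans (mk_sigma_formula_le l), ?_, ?_, ?_⟩
  · rintro _ ⟨p, rfl⟩; exact hS _ _
  · rintro _ ⟨p, rfl⟩; exact heS _ _
  · intro m ψ; exact ⟨_, ⟨⟨m, ψ⟩, rfl⟩, hdec m ψ⟩

/-- The data common to the arguments on isolated types: `B` is a complete set of size at most `μ`
with few types that satisfies a compactness property. -/
structure IsStableBase [L.IsRelational] [Nonempty C] (T : L.Theory) (κ μ : Cardinal.{u})
    (P : L.Relations 1) (B : Set C) : Prop where
  monster : IsMonster κ T C
  aleph0_lt : ℵ₀ < μ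
  powerlt : μ ^< μ = μ
  theoryCard_lt : theoryCard L < μ
  lt : μ < κ
  mk_le : #B ≤ μ
  count : #(Σ n : ℕ, StarTypes P B n) ≤ #B ^ theoryCard L
  compact : IsCompactIn L μ B B
  star : IsStarComplete P B B

variable [L.IsRelational] [Nonempty C] {T : L.Theory} {κ μ : Cardinal.{u}} {P : L.Relations 1}
  {B : Set C}

/-- Otherwise, every small consistent extension of `r` is split by an instance of `ψ` over `B`: each
finite intersection is split by some tuple of `B`, and compactness gives one tuple for all.
Witnesses in `P ∩ B` come from completeness and compactness of `B`, so the forbidden tree would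
exist. -/
theorem IsStableBase.exists_decides (h : IsStableBase T κ μ P B) {n m : ℕ}
    (ψ : L.Formula (Fin n ⊕ Fin m)) {r : Set (Set (Fin n → C))} (hr : #r < μ)
    (hdef : ∀ S ∈ r, B.Definable L S) (hfip : FIP r) :
    ∃ S, B.Definable L S ∧ Decides B ψ S ∧ FIP (insert S r) := by
  classical
  by_contra hno
  push Not at hno
  have hunion : ∀ r' : Set (Set (Fin n → C)), #r' < μ → #(r ∪ r' : Set (Set (Fin n → C))) < μ :=
    fun r' hr' => (Cardinal.mk_union_le _ _).trans_lt (Cardinal.add_lt_of_lt h.aleph0_lt.le hr hr')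
  have hudef : ∀ r' : Set (Set (Fin n → C)), (∀ S ∈ r', B.Definable L S) →
      ∀ S ∈ r ∪ r', B.Definable L S := by
    rintro r' hr' S (hS | hS)
    exacts [hdef S hS, hr' S hS]
  refine false_of_splitting h.monster h.aleph0_lt h.powerlt h.theoryCard_lt h.lt P h.mk_le h.count ψ
    (fun r' => FIP (r ∪ r')) ?_ ?_ (by simpa using hfip) ?_ ?_ ?_
  · intro r₁ r₂ h12 hfip s hs
    exact hfip s (hs.trans (union_subset_union_right _ h12))
  · intro r' h' s hs
    refine h' (s.filter (· ∈ r')) (fun S hS => ?_) s fun S hS => ?_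
    · exact (Finset.mem_filter.1 (Finset.mem_coe.1 hS)).2
    · rcases hs hS with h1 | h1
      · exact Or.inl h1
      · exact Or.inr (by simpa using ⟨hS, h1⟩)
  · intro r' h' s hs
    exact h' s (hs.trans subset_union_right)
  · intro r' hr' hgood hdef'
    have hd := hudef r' hdef'
    let V : Finset (r ∪ r' : Set (Set (Fin n → C))) → Set (Fin m → C) := fun s =>
      {a | (∃ x : Fin n → C, x ∈ subInter _ s ∧ ψ.Realize (Sum.elim x a)) ∧
        ∃ x : Fin n → C, x ∈ subInter _ s ∧ ¬ψ.Realize (Sum.elim x a)}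
    have hV : ∀ s, B.Definable L (V s) := by
      intro s
      have h1 : ∀ Ψ : Set (Fin n ⊕ Fin m → C), B.Definable L Ψ → B.Definable L
          {a : Fin m → C | ∃ x : Fin n → C, x ∈ subInter _ s ∧ Sum.elim x a ∈ Ψ} := by
        intro Ψ hΨ
        convert (((definable_subInter hd s).preimage_comp (β := Fin m ⊕ Fin n) Sum.inr).inter
          (definable_elim_comp hΨ Sum.inr Sum.inl)).exists_of_finite using 1
        ext a
        simp only [mem_ofPred_eq, mem_inter_iff, mem_preimage, Sum.elim_comp_inl, Sum.elim_comp_inr]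
      exact (h1 _ (definable_ofPred ψ _)).inter (h1 _ (definable_ofPred ψ _).compl)
    obtain ⟨a, ha, haB⟩ := h.compact.exists_of_directed (mk_finset_lt h.aleph0_lt (hunion r' hr')) V hV
      (fun s s' => ⟨s ∪ s', fun a ⟨⟨x, hx, hx'⟩, y, hy, hy'⟩ =>
          ⟨⟨x, subInter_union_left _ _ _ hx, hx'⟩, y, subInter_union_left _ _ _ hy, hy'⟩,
        fun a ⟨⟨x, hx, hx'⟩, y, hy, hy'⟩ =>
          ⟨⟨x, subInter_union_right _ _ _ hx, hx'⟩, y, subInter_union_right _ _ _ hy, hy'⟩⟩) (by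
      intro s
      -- A finite intersection that decided `ψ` could itself be added to `r`.
      have h1 : ¬Decides B ψ (subInter _ s) := by
        intro hdec
        refine hno _ (definable_subInter hd s) hdec (FIP_insert_iff.2 fun s' => ?_)
        obtain ⟨s'', hs''⟩ := exists_subInter_eq (r := r ∪ r')
          ((Finset.map_subtype_subset s').trans subset_union_left)
        obtain ⟨x, hx⟩ := FIP.nonempty_subInter hgood (s ∪ s'')
        have hx' := subInter_union_right _ _ _ hx
        rw [hs''] at hx'
        exact ⟨x, hx', subInter_union_left _ _ _ hx⟩
      unfold Decides at h1
      push Not at h1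
      obtain ⟨a, ha, ⟨x, hx, hx'⟩, y, hy, hy'⟩ := h1
      exact ⟨a, ⟨⟨y, hy, hy'⟩, x, hx, hx'⟩, ha⟩)
    refine ⟨a, haB, ?_, ?_⟩
    · rw [union_insert, FIP_insert_iff]
      intro s
      obtain ⟨x, hx, hx'⟩ := (ha s).1
      exact ⟨x, hx, hx'⟩
    · rw [union_insert, FIP_insert_iff]
      intro s
      obtain ⟨x, hx, hx'⟩ := (ha s).2
      exact ⟨x, hx, hx'⟩
  · intro r' hr' hgood hdef' j Y hY
    have hd := hudef r' hdef'
    rw [union_insert]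
    by_cases hg : FIP (insert {x : Fin n → C | ¬∃ z : Fin j → C, (∀ i, z i ∈ PPart C P) ∧
        Sum.elim x z ∈ Y} (r ∪ r'))
    · exact Or.inl hg
    right
    rw [FIP_insert_iff] at hg
    push Not at hg
    obtain ⟨s₀, hs₀⟩ := hg
    let V : Finset (r ∪ r' : Set (Set (Fin n → C))) → Set (Fin j → C) := fun s =>
      {z | (∀ i, z i ∈ PPart C P) ∧ ∃ x : Fin n → C, x ∈ subInter _ s ∧ Sum.elim x z ∈ Y}
    have hV : ∀ s, B.Definable L (V s) := by
      intro s
      have := (definable_pPart P B j id).inter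
        (((definable_subInter hd s).preimage_comp (β := Fin j ⊕ Fin n) Sum.inr).inter
          (definable_elim_comp hY Sum.inr Sum.inl)).exists_of_finite
      convert this using 1
      ext a
      simp only [mem_ofPred_eq, mem_inter_iff, mem_preimage, Sum.elim_comp_inl, Sum.elim_comp_inr,
        V, id]
    obtain ⟨b, hb, hbB⟩ := h.compact.exists_of_directed (mk_finset_lt h.aleph0_lt (hunion r' hr')) V hV
      (fun s s' => ⟨s ∪ s', fun a ⟨h0, x, hx, hx'⟩ => ⟨h0, x, subInter_union_left _ _ _ hx, hx'⟩,
        fun a ⟨h0, x, hx, hx'⟩ => ⟨h0, x, subInter_union_right _ _ _ hx, hx'⟩⟩) (by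
      intro s
      obtain ⟨x, hx⟩ := FIP.nonempty_subInter hgood (s ∪ s₀)
      -- The sets in `s₀` exclude that `x` has no witness in `P`.
      have hx' : ∃ z : Fin j → C, (∀ i, z i ∈ PPart C P) ∧ Sum.elim x z ∈ Y := by
        by_contra hx'
        exact eq_empty_iff_forall_notMem.1 hs₀ x ⟨subInter_union_right _ _ _ hx,
          fun z hz hzY => hx' ⟨z, hz, hzY⟩⟩
      obtain ⟨z, hz, hzY⟩ := hx'
      obtain ⟨b, hb, hbB⟩ := h.star j (V s) (hV s)
        ⟨z, ⟨hz, x, subInter_union_left _ _ _ hx, hzY⟩, hz⟩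
      exact ⟨b, hb, fun i => (hbB i).2⟩)
    refine ⟨b, fun i => ⟨(hb ∅).1 i, hbB i⟩, ?_⟩
    rw [union_insert, FIP_insert_iff]
    intro s
    obtain ⟨-, x, hx, hx'⟩ := hb s
    exact ⟨x, hx, hx'⟩

/-- An isolated tuple can be extended to an isolated tuple in a given definable set. -/
theorem IsStableBase.extend_isolated (h : IsStableBase T κ μ P B) {l k : ℕ} {e : Fin l → C}
    (he : IsIsolatedOver L B e) {G : Set (Fin (l + k) → C)} (hG : B.Definable L G)
    (hne : ∃ d : Fin k → C, Fin.append e d ∈ G) :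
    ∃ d : Fin k → C, Fin.append e d ∈ G ∧ IsIsolatedOver L B (Fin.append e d) := by
  classical
  have hreg := isRegular_of_powerlt_self h.aleph0_lt.le h.powerlt
  have hμ := h.aleph0_lt
  obtain ⟨r, hr, hrdef, her, hrdec⟩ := he.exists_family
  let pull : Set (Fin l → C) → Set (Fin (l + k) → C) := fun S => {v | v ∘ Fin.castAdd k ∈ S}
  have hpull : ∀ S, B.Definable L S → B.Definable L (pull S) := fun S hS =>
    hS.preimage_comp (Fin.castAdd k)
  let r₀ : Set (Set (Fin (l + k) → C)) := insert G (pull '' r)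
  have hr₀def : ∀ S ∈ r₀, B.Definable L S := by
    rintro S (rfl | ⟨S, hS, rfl⟩)
    exacts [hG, hpull S (hrdef S hS)]
  have hr₀ : #r₀ < μ := Cardinal.mk_insert_le.trans_lt (Cardinal.add_lt_of_lt hμ.le
    (Cardinal.mk_image_le.trans_lt (hr.trans_lt h.theoryCard_lt)) (Cardinal.one_lt_aleph0.trans hμ))
  let I := μ.ord.ToType
  let Q := Σ m : ℕ, L.Formula (Fin (l + k) ⊕ Fin m)
  obtain ⟨g, hg⟩ : ∃ g : I → Q, Function.Surjective g := by
    have : Nonempty Q := ⟨⟨0, ⊥⟩⟩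
    obtain ⟨⟨g, hg⟩⟩ : #Q ≤ #I := by
      rw [Cardinal.mk_ord_toType]
      exact (mk_sigma_formula_le (l + k)).trans h.theoryCard_lt.le
    exact ⟨Function.invFun g, Function.invFun_surjective hg⟩
  let Good : Set (Set (Fin (l + k) → C)) → Prop := fun r' =>
    FIP (r₀ ∪ r') ∧ ∀ S ∈ r', B.Definable L S
  have hstep : ∀ (i : I) (r' : Set (Set (Fin (l + k) → C))), ∃ S, #r' < μ → Good r' →
      Decides B (g i).2 S ∧ Good (r' ∪ {S}) := by
    intro i r'
    by_cases hr' : #r' < μ ∧ Good r'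
    swap
    · exact ⟨∅, fun h1 h2 => absurd ⟨h1, h2⟩ hr'⟩
    obtain ⟨hr', hgood⟩ := hr'
    obtain ⟨S, hS, hdec, hfip⟩ := h.exists_decides (g i).2 (r := r₀ ∪ r')
      ((Cardinal.mk_union_le _ _).trans_lt (Cardinal.add_lt_of_lt hμ.le hr₀ hr')) (by
        rintro S (hS | hS)
        exacts [hr₀def S hS, hgood.2 S hS]) hgood.1
    refine ⟨S, fun _ _ => ⟨hdec, ?_, ?_⟩⟩
    · rwa [← union_assoc, union_singleton]
    · rintro S' (hS' | rfl)
      exacts [hgood.2 S' hS', hS]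
  choose t ht using hstep
  -- A deciding set is added for each formula in `l + k` variables, keeping consistency with `G` and
  -- with the sets that isolate `e`.
  obtain ⟨hst, hall⟩ := stages_good hreg Good
    (fun r₁ r₂ h12 hr => ⟨fun s hs => hr.1 s (hs.trans (union_subset_union_right _ h12)),
      fun S hS => hr.2 S (h12 hS)⟩)
    (by
      intro r' h'
      refine ⟨fun s hs => ?_, fun S hS => (h' {S} (by simpa)).2 S (by simp)⟩
      refine (h' (s.filter (· ∈ r')) (fun S hS => ?_)).1 s fun S hS => ?_
      · exact (Finset.mem_filter.1 (Finset.mem_coe.1 hS)).2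
      · rcases hs hS with h1 | h1
        · exact Or.inl h1
        · exact Or.inr (by simpa using ⟨hS, h1⟩))
    (by
      refine ⟨?_, by simp⟩
      rw [union_empty]
      intro s hs
      obtain ⟨d, hd⟩ := hne
      refine ⟨Fin.append e d, mem_sInter.2 fun S hS => ?_⟩
      rcases hs hS with rfl | ⟨S', hS', rfl⟩
      · exact hd
      · have : Fin.append e d ∘ Fin.castAdd k = e := by funext i; simp
        simpa [pull, this] using her S' hS')
    (fun i r' => {t i r'})
    (fun i r' _ _ => by simpa using Cardinal.one_lt_aleph0.trans hμ)
    (fun i r' hr' hgood => (ht i r' hr' hgood).2)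
  set U := ⋃ i, ({t i (stages (fun i r' => {t i r'}) i)} : Set (Set (Fin (l + k) → C)))
  have hUdef : ∀ S ∈ r₀ ∪ U, B.Definable L S := by
    rintro S (hS | hS)
    exacts [hr₀def S hS, hall.2 S hS]
  obtain ⟨d, hd⟩ := h.monster.nonempty_sInter (D := B ∪ range e)
    (F := (fun S : Set (Fin (l + k) → C) => {d : Fin k → C | Fin.append e d ∈ S}) '' (r₀ ∪ U))
    (by
      refine (Cardinal.mk_union_le _ _).trans_lt (Cardinal.add_lt_of_lt (hμ.trans h.lt).le
        (h.mk_le.trans_lt h.lt) ?_)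
      exact (Cardinal.lt_aleph0_of_finite _).trans (hμ.trans h.lt))
    (by
      rintro _ ⟨S, hS, rfl⟩
      have h1 := definable_fiber_left (D := B ∪ range e) (((hUdef S hS).mono
        subset_union_left).preimage_comp (finSumFinEquiv.symm : Fin (l + k) → Fin l ⊕ Fin k)) e
        fun i => Or.inr (mem_range_self i)
      convert h1 using 1
      ext d
      simp only [mem_ofPred_eq, mem_preimage]
      refine iff_of_eq (congrArg (· ∈ S) ?_)
      funext i
      refine Fin.addCases (fun i => ?_) (fun i => ?_) i <;> simp)
    (by
      intro s hs
      have hs' : ∀ S ∈ s, ∃ S' ∈ r₀ ∪ U, {d : Fin k → C | Fin.append e d ∈ S'} = S :=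
        fun S hS => hs hS
      choose! f hf using hs'
      have hfsub : ((s.image f : Finset _) : Set (Set (Fin (l + k) → C))) ⊆ r₀ ∪ U := by
        intro S hS
        obtain ⟨S', hS', rfl⟩ := Finset.mem_image.1 (Finset.mem_coe.1 hS)
        exact (hf S' hS').1
      -- The first `l` coordinates must be `e` itself. The projection of a finite intersection is
      -- `B`-definable, hence decided on some `S` in `r`; it meets `S` by consistency, so it
      -- contains `S` and with it `e`.
      have hproj : B.Definable L {e' : Fin l → C | ∃ d : Fin k → C, Sum.elim e' d ∈
          {v : Fin l ⊕ Fin k → C | v ∘ finSumFinEquiv.symm ∈ ⋂₀ (↑(s.image f) : Set (Set (Fin (l + k) → C)))}} :=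
        ((definable_sInter (s.image f) fun S hS => hUdef S (hfsub hS)).preimage_comp
          finSumFinEquiv.symm).exists_of_finite
      obtain ⟨m, χ, b, hb, hχ⟩ := definable_iff_fiber.1 hproj
      obtain ⟨S, hSr, hdec⟩ := hrdec m χ
      have hmem : e ∈ {e' : Fin l → C | χ.Realize (Sum.elim e' b)} := by
        rcases hdec b hb with h1 | h1
        · exact h1 e (her S hSr)
        · exfalso
          obtain ⟨v, hv⟩ := hall.1 (insert (pull S) (s.image f)) (by
            rw [Finset.coe_insert]
            exact insert_subset (Or.inl (Or.inr ⟨S, hSr, rfl⟩)) hfsub)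
          rw [Finset.coe_insert, sInter_insert] at hv
          refine h1 (v ∘ Fin.castAdd k) hv.1 ?_
          have : v ∘ Fin.castAdd k ∈ {e' : Fin l → C | χ.Realize (Sum.elim e' b)} := by
            rw [← hχ]
            refine ⟨v ∘ Fin.natAdd l, ?_⟩
            have : (Sum.elim (v ∘ Fin.castAdd k) (v ∘ Fin.natAdd l)) ∘ finSumFinEquiv.symm = v := by
              funext i
              refine Fin.addCases (fun i => ?_) (fun i => ?_) i <;> simp
            rw [mem_ofPred_eq, this]
            exact hv.2
          exact this
      rw [← hχ] at hmem
      obtain ⟨d, hd⟩ := hmem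
      refine ⟨d, mem_sInter.2 fun S hS => ?_⟩
      rw [← (hf S hS).2]
      have h2 := mem_sInter.1 hd (f S) (by simpa using ⟨S, hS, rfl⟩)
      have h3 : (Sum.elim e d) ∘ finSumFinEquiv.symm = Fin.append e d := by
        funext i
        refine Fin.addCases (fun i => ?_) (fun i => ?_) i <;> simp
      rwa [h3] at h2)
  have hd' : ∀ S ∈ r₀ ∪ U, Fin.append e d ∈ S := fun S hS => mem_sInter.1 hd _ ⟨S, hS, rfl⟩
  refine ⟨d, hd' G (Or.inl (Or.inl rfl)), fun m ψ => ?_⟩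
  obtain ⟨i, hi⟩ := hg ⟨m, ψ⟩
  have hU : t i (stages (fun i r' => {t i r'}) i) ∈ U := mem_iUnion.2 ⟨i, rfl⟩
  refine ⟨_, hall.2 _ hU, hd' _ (Or.inr hU), ?_⟩
  have := (ht i _ (hst i).1 (hst i).2).1
  rw [hi] at this
  exact this

/-- Extending `e` inside the set that fixes the last coordinates to be `b` leaves only one choice.
-/
theorem IsStableBase.append_mem (h : IsStableBase T κ μ P B) {l k : ℕ} {e : Fin l → C}
    (he : IsIsolatedOver L B e) {b : Fin k → C} (hb : ∀ i, b i ∈ B) :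
    IsIsolatedOver L B (Fin.append e b) := by
  obtain ⟨d, hd, hiso⟩ := h.extend_isolated he (definable_eq_point (L := L) (Fin.natAdd l) hb)
    ⟨b, by funext i; simp⟩
  have : d = b := by
    rw [← (hd : _ = b)]
    funext i
    simp
  rwa [this] at hiso

end

/-! ### Definability of a single type -/

section

variable {L : FirstOrder.Language.{u, u}} {C : Type u} [L.Structure C]

theorem definable_hasRank_inter (P : L.Relations 1) {n m : ℕ} (ψ : L.Formula (Fin n ⊕ Fin m))
    (Δ : Finset (Task L n)) (j : ℕ) {α β γ : Type} {D : Set C} {q : Set (α ⊕ Fin n → C)}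
    (hq : D.Definable L q) {Y : Set (Fin n ⊕ β → C)} (hY : D.Definable L Y)
    (f : α → γ) (g : β → γ) :
    D.Definable L {w : γ → C | HasRank P ψ Δ j
      ({x | Sum.elim (w ∘ f) x ∈ q} ∩ {x | Sum.elim x (w ∘ g) ∈ Y})} := by
  convert definable_hasRank P ψ Δ j (α := γ) ((definable_elim_comp hq (Sum.inl ∘ f)
    (Sum.inr : Fin n → γ ⊕ Fin n)).inter (definable_elim_comp hY Sum.inr (Sum.inl ∘ g))) using 1
  rfl

theorem definable_taskPos' {n : ℕ} (τ : Task L n) (D : Set C) :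
    D.Definable L {v : Fin n ⊕ (Fin τ.1 ⊕ Fin τ.2.1) → C |
      v ∘ Sum.inl ∈ taskPos τ (v ∘ Sum.inr ∘ Sum.inl) (v ∘ Sum.inr ∘ Sum.inr)} :=
  (definable_taskPos τ D).preimage_comp
    (Sum.elim (Sum.elim Sum.inl (Sum.inr ∘ Sum.inl)) (Sum.inr ∘ Sum.inr))

/-- If `S` isolates `e` for the formula that defines `G`, then `G(e, a)` is equivalent, for `a` in
`B`, to `G(w, a)` for all `w` in `S`, a condition over `B`. -/
theorem IsIsolatedOver.exists_uniform {B : Set C} {l n m : ℕ} {e : Fin l → C} (he : IsIsolatedOver L B e)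
    {c : Fin n → C} {ψ : L.Formula (Fin n ⊕ Fin m)} {G : Set (Fin l ⊕ Fin m → C)}
    (hG : (∅ : Set C).Definable L G)
    (h : ∀ a : Fin m → C, (∀ i, a i ∈ B) → (ψ.Realize (Sum.elim c a) ↔ Sum.elim e a ∈ G)) :
    ∃ (k : ℕ) (Φ : L.Formula (Fin m ⊕ Fin k)) (d : Fin k → C), (∀ i, d i ∈ B) ∧
      ∀ a : Fin m → C, (∀ i, a i ∈ B) → (ψ.Realize (Sum.elim c a) ↔ Φ.Realize (Sum.elim a d)) := by
  obtain ⟨g, rfl⟩ := empty_definable_iff.1 hG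
  obtain ⟨S, hS, heS, hdec⟩ := he m g
  have hdef : B.Definable L {a : Fin m → C | ∀ w : Fin l → C, w ∈ S → g.Realize (Sum.elim w a)} := by
    have := ((hS.preimage_comp (β := Fin m ⊕ Fin l) Sum.inr).compl.union
      (definable_elim_comp (definable_ofPred g B) Sum.inr Sum.inl)).forall_of_finite
    convert this using 1
    ext a
    simp only [mem_ofPred_eq, mem_union, mem_compl_iff, mem_preimage, Sum.elim_comp_inl,
      Sum.elim_comp_inr, imp_iff_not_or]
  obtain ⟨k, Φ, d, hd, hΦ⟩ := definable_iff_fiber.1 hdef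
  refine ⟨k, Φ, d, hd, fun a ha => (h a ha).trans ?_⟩
  have h1 : Φ.Realize (Sum.elim a d) ↔ ∀ w : Fin l → C, w ∈ S → g.Realize (Sum.elim w a) :=
    (Set.ext_iff.1 hΦ a).symm
  rw [h1]
  refine ⟨fun hga => (hdec a ha).resolve_right fun h2 => h2 e heS hga, fun h2 => h2 e heS⟩

theorem isIsolatedOver_elim0 (B : Set C) (e : Fin 0 → C) : IsIsolatedOver L B e := by
  intro m ψ
  refine ⟨univ, definable_univ, mem_univ _, fun a _ => ?_⟩
  by_cases h : ψ.Realize (Sum.elim e a)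
  · exact Or.inl fun x _ => by rwa [Subsingleton.elim x e]
  · exact Or.inr fun x _ => by rwa [Subsingleton.elim x e]

variable [L.IsRelational] [Nonempty C] {T : L.Theory} {κ μ : Cardinal.{u}} {P : L.Relations 1}
  {B : Set C}

/-- A type over `B` in `S_*(B)` is definable, if it satisfies a compactness property. -/
theorem IsStableBase.exists_definition (h : IsStableBase T κ μ P B) {n m : ℕ}
    (ψ : L.Formula (Fin n ⊕ Fin m)) {c : Fin n → C} (hcomp : IsCompactIn L μ (B ∪ range c) B)
    (hstar : IsStarComplete P (B ∪ range c) B) (Δ : Finset (Task L n)) (j : ℕ) :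
    ∀ (l : ℕ) (e : Fin l → C) (q : Set (Fin l ⊕ Fin n → C)), (∅ : Set C).Definable L q →
      IsIsolatedOver L B e → Sum.elim e c ∈ q → ¬HasRank P ψ Δ j {x | Sum.elim e x ∈ q} →
      ∃ (k : ℕ) (Φ : L.Formula (Fin m ⊕ Fin k)) (d : Fin k → C), (∀ i, d i ∈ B) ∧
        ∀ a : Fin m → C, (∀ i, a i ∈ B) →
          (ψ.Realize (Sum.elim c a) ↔ Φ.Realize (Sum.elim a d)) := by
  classical
  induction j with
  | zero => exact fun l e q _ _ hc hr => absurd ⟨c, hc⟩ hr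
  | succ j ih =>
  intro l e q hq he hc hr
  -- The inductive step: a new isolated tuple `E` and a further condition `Y` that holds of `c` and
  -- lowers the rank.
  have next : ∀ (l' : ℕ) (E : Fin l' → C) (β : Type) (Y : Set (Fin n ⊕ β → C)) (f : Fin l → Fin l')
      (g : β → Fin l'), (∅ : Set C).Definable L Y → IsIsolatedOver L B E →
      Sum.elim (E ∘ f) c ∈ q → Sum.elim c (E ∘ g) ∈ Y →
      ¬HasRank P ψ Δ j ({x | Sum.elim (E ∘ f) x ∈ q} ∩ {x | Sum.elim x (E ∘ g) ∈ Y}) →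
      ∃ (k : ℕ) (Φ : L.Formula (Fin m ⊕ Fin k)) (d : Fin k → C), (∀ i, d i ∈ B) ∧
        ∀ a : Fin m → C, (∀ i, a i ∈ B) →
          (ψ.Realize (Sum.elim c a) ↔ Φ.Realize (Sum.elim a d)) := by
    intro l' E β Y f g hY hE hcq hcY hr'
    exact ih l' E _ ((definable_elim_comp hq (Sum.inl ∘ f)
      (Sum.inr : Fin n → Fin l' ⊕ Fin n)).inter (definable_elim_comp hY Sum.inr (Sum.inl ∘ g)))
      hE ⟨hcq, hcY⟩ hr'
  have hleft : ∀ {k : ℕ} (u : Fin l → C) (v : Fin k → C), Fin.append u v ∘ Fin.castAdd k = u :=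
    fun u v => by funext i; simp
  have hright : ∀ {k l : ℕ} (u : Fin l → C) (v : Fin k → C), Fin.append u v ∘ Fin.natAdd l = v :=
    fun u v => by funext i; simp
  have hψ : (∅ : Set C).Definable L {v : Fin n ⊕ Fin m → C | ψ.Realize v} := definable_ofPred ψ _
  by_cases hsplit : ∃ a : Fin m → C, (∀ i, a i ∈ B) ∧
      ((ψ.Realize (Sum.elim c a) ∧
        ¬HasRank P ψ Δ j ({x | Sum.elim e x ∈ q} ∩ {x | ψ.Realize (Sum.elim x a)})) ∨
      (¬ψ.Realize (Sum.elim c a) ∧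
        ¬HasRank P ψ Δ j ({x | Sum.elim e x ∈ q} ∩ {x | ψ.Realize (Sum.elim x a)}ᶜ)))
  · obtain ⟨a, haB, ⟨h1, h2⟩ | ⟨h1, h2⟩⟩ := hsplit
    · refine next _ (Fin.append e a) _ _ (Fin.castAdd m) (Fin.natAdd l) hψ (h.append_mem he haB) ?_ ?_ ?_
      all_goals simpa only [hleft, hright]
    · refine next _ (Fin.append e a) _ _ (Fin.castAdd m) (Fin.natAdd l) hψ.compl
        (h.append_mem he haB) ?_ ?_ ?_
      all_goals simpa only [hleft, hright]
  have hrank : ∀ a : Fin m → C, (∀ i, a i ∈ B) →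
      (ψ.Realize (Sum.elim c a) →
        HasRank P ψ Δ j ({x | Sum.elim e x ∈ q} ∩ {x | ψ.Realize (Sum.elim x a)})) ∧
      (¬ψ.Realize (Sum.elim c a) →
        HasRank P ψ Δ j ({x | Sum.elim e x ∈ q} ∩ {x | ψ.Realize (Sum.elim x a)}ᶜ)) :=
    fun a ha => ⟨fun h1 => by_contra fun h2 => hsplit ⟨a, ha, Or.inl ⟨h1, h2⟩⟩,
      fun h1 => by_contra fun h2 => hsplit ⟨a, ha, Or.inr ⟨h1, h2⟩⟩⟩
  -- Here `a` ranges over all of `C`. Without such an `a`, largeness of the rank decides `ψ(c, a)`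
  -- for every `a` in `B`.
  by_cases hboth : ∃ a : Fin m → C,
      HasRank P ψ Δ j ({x | Sum.elim e x ∈ q} ∩ {x | ψ.Realize (Sum.elim x a)}) ∧
      HasRank P ψ Δ j ({x | Sum.elim e x ∈ q} ∩ {x | ψ.Realize (Sum.elim x a)}ᶜ)
  swap
  · refine he.exists_uniform
      (definable_hasRank_inter P ψ Δ j hq hψ (Sum.inl : Fin l → Fin l ⊕ Fin m) Sum.inr) fun a ha => ?_
    refine ⟨(hrank a ha).1, fun h1 => ?_⟩
    by_contra h2
    exact hboth ⟨a, h1, (hrank a ha).2 h2⟩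
  -- Since the splitting clause of rank `j + 1` holds, it is a witness clause that fails.
  have htask : ∃ τ ∈ Δ, ∃ d : Fin τ.1 → C,
      ¬HasRank P ψ Δ j ({x | Sum.elim e x ∈ q} ∩ taskNeg P τ d) ∧
      ∀ b : Fin τ.2.1 → C, (∀ i, b i ∈ PPart C P) →
        ¬HasRank P ψ Δ j ({x | Sum.elim e x ∈ q} ∩ taskPos τ d b) := by
    by_contra hno
    refine hr ⟨hboth, fun τ hτ d => ?_⟩
    by_contra h1
    rw [not_or] at h1
    exact hno ⟨τ, hτ, d, h1.1, fun b hb hb' => h1.2 ⟨b, hb, hb'⟩⟩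
  obtain ⟨τ, -, d₀, hd₀⟩ := htask
  let G : Set (Fin (l + τ.1) → C) := {v |
    ¬HasRank P ψ Δ j ({x | Sum.elim (v ∘ Fin.castAdd τ.1) x ∈ q} ∩ taskNeg P τ (v ∘ Fin.natAdd l)) ∧
      ∀ b : Fin τ.2.1 → C, (∀ i, b i ∈ PPart C P) → ¬HasRank P ψ Δ j
        ({x | Sum.elim (v ∘ Fin.castAdd τ.1) x ∈ q} ∩ taskPos τ (v ∘ Fin.natAdd l) b)}
  have hG : (∅ : Set C).Definable L G := by
    have h1 := (definable_hasRank_inter P ψ Δ j hq (definable_taskNeg (P := P) τ ∅)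
      (Fin.castAdd τ.1) (Fin.natAdd l)).compl
    have h2 := definable_hasRank_inter P ψ Δ j hq (definable_taskPos' τ ∅)
      (γ := Fin (l + τ.1) ⊕ Fin τ.2.1) (Sum.inl ∘ Fin.castAdd τ.1)
      (Sum.map (Fin.natAdd l) id)
    have h3 := ((definable_pPart P ∅ _ Sum.inr).compl.union h2.compl).forall_of_finite
    convert h1.inter h3 using 1
    ext v
    simp only [G, mem_inter_iff, mem_ofPred_eq, mem_union, mem_compl_iff, imp_iff_not_or]
    rfl
  obtain ⟨d, hdG, hiso⟩ := h.extend_isolated he (hG.mono (empty_subset B)) ⟨d₀, by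
    simpa only [G, mem_ofPred_eq, hleft, hright] using hd₀⟩
  by_cases hneg : c ∈ taskNeg P τ d
  · refine next _ _ _ _ (Fin.castAdd τ.1) (Fin.natAdd l) (definable_taskNeg (P := P) τ ∅) hiso ?_ ?_ hdG.1
    · simpa only [hleft]
    · simpa only [hright, mem_ofPred_eq, Sum.elim_comp_inl, Sum.elim_comp_inr]
  obtain ⟨z, hzP, hz⟩ : ∃ z : Fin τ.2.1 → C, (∀ i, z i ∈ PPart C P) ∧ c ∈ taskPos τ d z :=
    not_not.1 hneg
  obtain ⟨r, hrcard, hrdef, hEr, hrdec⟩ := hiso.exists_family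
  -- The witness `z` for `c` lies in `P` but perhaps not in `B`, and `d` need not lie in `B`, so
  -- completeness of `B ∪ c` does not apply to `d` directly. The pair `(e, d)` is therefore
  -- quantified out: `b` in `P ∩ B` is sought such that some `E`, subject to the same isolating sets
  -- and to `F`, makes `b` a witness for `c`; this `E` then replaces `(e, d)`.
  let F : Set (Fin (l + τ.1) → C) := {v | v ∈ G ∧ Sum.elim (v ∘ Fin.castAdd τ.1) c ∈ q}
  have hcD : ∀ i, c i ∈ B ∪ range c := fun i => Or.inr (mem_range_self i)
  have hF : (B ∪ range c).Definable L F :=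
    (hG.mono (empty_subset _)).inter (definable_fiber (definable_elim_comp
      (hq.mono (empty_subset (B ∪ range c))) (Sum.inl ∘ Fin.castAdd τ.1 : _ → Fin (l + τ.1) ⊕ Fin n)
      Sum.inr) c hcD)
  let r' := insert F r
  have hr'def : ∀ S ∈ r', (B ∪ range c).Definable L S := by
    rintro S (rfl | hS)
    exacts [hF, (hrdef S hS).mono subset_union_left]
  have hr' : #r' < μ := Cardinal.mk_insert_le.trans_lt (Cardinal.add_lt_of_lt h.aleph0_lt.le
    (hrcard.trans_lt h.theoryCard_lt) (Cardinal.one_lt_aleph0.trans h.aleph0_lt))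
  let X : (Fin τ.2.1 → C) → Set (Fin (l + τ.1) → C) := fun b => {v | c ∈ taskPos τ (v ∘ Fin.natAdd l) b}
  have hXdef : (B ∪ range c).Definable L {w : Fin τ.2.1 ⊕ Fin (l + τ.1) → C |
      w ∘ Sum.inr ∈ X (w ∘ Sum.inl)} :=
    definable_fiber ((definable_taskPos' τ (B ∪ range c)).preimage_comp
      (Sum.elim Sum.inr (Sum.elim (Sum.inl ∘ Sum.inr ∘ Fin.natAdd l) (Sum.inl ∘ Sum.inl)) :
        _ → (Fin τ.2.1 ⊕ Fin (l + τ.1)) ⊕ Fin n)) c hcD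
  let V : Finset r' → Set (Fin τ.2.1 → C) := fun s =>
    {b | (∀ i, b i ∈ PPart C P) ∧ ∃ v : Fin (l + τ.1) → C, v ∈ subInter r' s ∧ v ∈ X b}
  have hV : ∀ s, (B ∪ range c).Definable L (V s) := fun s =>
    (definable_pPart P _ _ id).inter
      (((definable_subInter hr'def s).preimage_comp Sum.inr).inter hXdef).exists_of_finite
  have hE : ∀ s, Fin.append e d ∈ subInter r' s := by
    intro s
    refine mem_sInter.2 fun S hS => ?_
    rcases Finset.map_subtype_subset s hS with rfl | hS'
    · exact ⟨hdG, by simpa only [hleft]⟩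
    · exact hEr S hS'
  obtain ⟨b, hb, hbB⟩ := hcomp.exists_of_directed (mk_finset_lt h.aleph0_lt hr') V hV
    (fun s s' => ⟨s ∪ s', fun a ⟨h0, x, hx, hx'⟩ => ⟨h0, x, subInter_union_left _ _ _ hx, hx'⟩,
      fun a ⟨h0, x, hx, hx'⟩ => ⟨h0, x, subInter_union_right _ _ _ hx, hx'⟩⟩) (by
    intro s
    obtain ⟨b, hb, hbB⟩ := hstar _ (V s) (hV s) ⟨z, ⟨hzP, _, hE s, by
      simpa only [X, mem_ofPred_eq, hright]⟩, hzP⟩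
    exact ⟨b, hb, fun i => (hbB i).2⟩)
  obtain ⟨E, hEmem⟩ := h.monster.nonempty_sInter (D := B ∪ range c) (F := insert (X b) r') (by
      refine (Cardinal.mk_union_le _ _).trans_lt (Cardinal.add_lt_of_lt (h.aleph0_lt.trans h.lt).le
        (h.mk_le.trans_lt h.lt) ?_)
      exact (Cardinal.lt_aleph0_of_finite _).trans (h.aleph0_lt.trans h.lt))
    (by
      rintro S (rfl | hS)
      · exact definable_fiber_left hXdef b fun i => Or.inl (hbB i)
      · exact hr'def S hS)
    (FIP_insert_iff.2 fun s => (hb s).2)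
  rw [sInter_insert, sInter_insert] at hEmem
  obtain ⟨hEX, ⟨hEG, hEq⟩, hEr'⟩ := hEmem
  have hEiso : IsIsolatedOver L B E := fun m' ψ' => by
    obtain ⟨S, hS, hdec⟩ := hrdec m' ψ'
    exact ⟨S, hrdef S hS, mem_sInter.1 hEr' S hS, hdec⟩
  have hcomp1 : Fin.append E b ∘ Fin.castAdd τ.2.1 = E := by funext i; simp
  refine next _ (Fin.append E b) _ _ (Fin.castAdd τ.2.1 ∘ Fin.castAdd τ.1)
    (Sum.elim (Fin.castAdd τ.2.1 ∘ Fin.natAdd l) (Fin.natAdd (l + τ.1)))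
    (definable_taskPos' τ ∅) (h.append_mem hEiso hbB) ?_ ?_ ?_
  · rwa [← Function.comp_assoc, hcomp1]
  · simp only [Sum.comp_elim, ← Function.comp_assoc, hcomp1, hright, mem_ofPred_eq,
      Sum.elim_comp_inl, Sum.elim_comp_inr]
    exact hEX
  · simp only [Sum.comp_elim, ← Function.comp_assoc, hcomp1, hright, mem_ofPred_eq,
      Sum.elim_comp_inl, Sum.elim_comp_inr]
    exact hEG.2 b (hb ∅).1

end

/-! ### Pairs consisting of a structure and a marked subset -/

section Relativize

variable {L L' : FirstOrder.Language.{u, u}}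

/-- The relativization of an `L`-formula to a predicate `Q` of a language that extends `L`. -/
def relativize (g : L →ᴸ L') (Q : L'.Relations 1) {α : Type*} :
    ∀ {k : ℕ}, L.BoundedFormula α k → L'.BoundedFormula α k
  | _, .falsum => .falsum
  | _, .equal t₁ t₂ => .equal (g.onTerm t₁) (g.onTerm t₂)
  | _, .rel R ts => .rel (g.onRelation R) fun i => g.onTerm (ts i)
  | _, .imp φ₁ φ₂ => .imp (relativize g Q φ₁) (relativize g Q φ₂)
  | k, .all φ => .all ((Q.boundedFormula ![Term.var (Sum.inr (Fin.last k))]).imp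
      (relativize g Q φ))

/-- This makes the theory of the induced structure on `Q` a part of the theory of the pair, so that
compactness can preserve it. -/
theorem realize_relativize (g : L →ᴸ L') (Q : L'.Relations 1) {N D : Type u} [L.Structure N]
    [L'.Structure N] [g.IsExpansionOn N] [L.Structure D] (f : D ↪[L] N)
    (hf : range f = PPart N Q) {α : Type*} {k : ℕ} (φ : L.BoundedFormula α k) (v : α → D)
    (xs : Fin k → D) : (relativize g Q φ).Realize (f ∘ v) (f ∘ xs) ↔ φ.Realize v xs := by
  induction φ with
  | falsum => rfl
  | equal t₁ t₂ =>
    simp only [relativize, BoundedFormula.Realize, LHom.realize_onTerm, ← Sum.comp_elim,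
      HomClass.realize_term, f.injective.eq_iff]
  | rel R ts =>
    simp only [relativize, BoundedFormula.Realize, LHom.realize_onTerm, ← Sum.comp_elim,
      HomClass.realize_term, LHom.map_onRelation]
    exact f.map_rel R _
  | imp φ₁ φ₂ ih₁ ih₂ => simp only [relativize, BoundedFormula.Realize, ih₁, ih₂]
  | all φ ih =>
    have hQ : ∀ x : N, (Q.boundedFormula ![Term.var (Sum.inr (Fin.last _))]).Realize (f ∘ v)
        (Fin.snoc (f ∘ xs) x : Fin _ → N) ↔ x ∈ range f := by
      intro x
      rw [hf, BoundedFormula.realize_rel]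
      refine iff_of_eq (congrArg _ ?_)
      funext i
      simp
    have hsnoc : ∀ d : D, (Fin.snoc (f ∘ xs) (f d) : Fin _ → N) = f ∘ (Fin.snoc xs d : Fin _ → D) :=
      fun d => (Fin.comp_snoc f xs d).symm
    simp only [relativize, BoundedFormula.Realize] at ih ⊢
    constructor
    · intro h d
      have := h (f d) ((hQ _).2 (mem_range_self d))
      rwa [hsnoc, ih] at this
    · intro h x hx
      obtain ⟨d, rfl⟩ := (hQ _).1 hx
      rw [hsnoc, ih]
      exact h d

/-- All members of a tuple satisfy a monadic predicate. -/
noncomputable def tupleIn (Q : L.Relations 1) {α : Type*} {k : ℕ} (f : Fin k → α) : L.Formula α :=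
  Formula.iInf fun i => Q.formula ![Term.var (f i)]

theorem realize_tupleIn {Q : L.Relations 1} {α : Type*} {k : ℕ} {f : Fin k → α} {N : Type u}
    [L.Structure N] {v : α → N} : (tupleIn Q f).Realize v ↔ ∀ i, v (f i) ∈ PPart N Q := by
  simp only [tupleIn, Formula.realize_iInf, Formula.realize_rel, PPart]
  refine forall_congr' fun i => iff_of_eq (congrArg _ ?_)
  funext k
  simp

/-- Whenever `φ(x, y, z)`, with `y` in `Q`, has a solution `z` in `P`, it has one in `P ∩ Q`. -/
noncomputable def witnessFormula (g : L →ᴸ L') (P : L.Relations 1) (Q : L'.Relations 1)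
    {n k j : ℕ} (φ : L.Formula ((Fin n ⊕ Fin k) ⊕ Fin j)) : L'.Formula (Fin n) :=
  ∼((tupleIn Q Sum.inr ⊓ (((g.onFormula (φ ⊓ tupleIn P Sum.inr)).iExs (Fin j)) ⊓
    ∼((g.onFormula (φ ⊓ tupleIn P Sum.inr) ⊓ tupleIn Q Sum.inr).iExs (Fin j)))).iExs (Fin k))

theorem realize_witnessFormula (g : L →ᴸ L') (P : L.Relations 1) (Q : L'.Relations 1)
    {N : Type u} [L.Structure N] [L'.Structure N] [g.IsExpansionOn N]
    {n k j : ℕ} (φ : L.Formula ((Fin n ⊕ Fin k) ⊕ Fin j)) (c : Fin n → N) :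
    (witnessFormula g P Q φ).Realize c ↔ ∀ y : Fin k → N, (∀ i, y i ∈ PPart N Q) →
      (∃ z : Fin j → N, φ.Realize (Sum.elim (Sum.elim c y) z) ∧ ∀ i, z i ∈ PPart N P) →
      ∃ z : Fin j → N, (φ.Realize (Sum.elim (Sum.elim c y) z) ∧ ∀ i, z i ∈ PPart N P) ∧
        ∀ i, z i ∈ PPart N Q := by
  simp only [witnessFormula, Formula.realize_not, Formula.realize_iExs, Formula.realize_inf,
    realize_tupleIn, LHom.realize_onFormula, Sum.elim_inr]
  push Not
  rfl

/-- For all `d` in `Q`, the formulas `ψ(c, y)` and `Φ(y, d)` differ at some `y` in `Q`. -/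
noncomputable def differFormula (g : L →ᴸ L') (Q : L'.Relations 1) {n m k : ℕ}
    (ψ : L.Formula (Fin n ⊕ Fin m)) (Φ : L.Formula (Fin m ⊕ Fin k)) : L'.Formula (Fin n) :=
  ∼((tupleIn Q Sum.inr ⊓ ∼((tupleIn Q Sum.inr ⊓ ∼(g.onFormula
    ((ψ.relabel (Sum.elim (fun i => Sum.inl (Sum.inl i)) Sum.inr)).iff
      (Φ.relabel (Sum.elim Sum.inr fun i => Sum.inl (Sum.inr i)))))).iExs (Fin m))).iExs (Fin k))

theorem realize_differFormula (g : L →ᴸ L') (Q : L'.Relations 1)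
    {N : Type u} [L.Structure N] [L'.Structure N] [g.IsExpansionOn N] {n m k : ℕ}
    (ψ : L.Formula (Fin n ⊕ Fin m)) (Φ : L.Formula (Fin m ⊕ Fin k)) (c : Fin n → N) :
    (differFormula g Q ψ Φ).Realize c ↔ ∀ d : Fin k → N, (∀ i, d i ∈ PPart N Q) →
      ∃ a : Fin m → N, (∀ i, a i ∈ PPart N Q) ∧
        ¬(ψ.Realize (Sum.elim c a) ↔ Φ.Realize (Sum.elim a d)) := by
  have h1 : ∀ (d : Fin k → N) (a : Fin m → N), (Sum.elim (Sum.elim c d) a ∘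
      Sum.elim (fun i => Sum.inl (Sum.inl i)) Sum.inr : Fin n ⊕ Fin m → N) = Sum.elim c a := by
    intro d a; funext i; rcases i with i | i <;> rfl
  have h2 : ∀ (d : Fin k → N) (a : Fin m → N), (Sum.elim (Sum.elim c d) a ∘
      Sum.elim Sum.inr fun i => Sum.inl (Sum.inr i) : Fin m ⊕ Fin k → N) = Sum.elim a d := by
    intro d a; funext i; rcases i with i | i <;> rfl
  simp only [differFormula, Formula.realize_not, Formula.realize_iExs, Formula.realize_inf,
    realize_tupleIn, LHom.realize_onFormula, Sum.elim_inr, Formula.realize_iff,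
    Formula.realize_relabel, h1, h2, not_exists, not_and, not_not]
  push Not
  rfl

end Relativize

section Compactness

variable {L : FirstOrder.Language.{u, u}}

theorem exists_realization {α : Type} (Γ : Set (L.Formula α))
    (h : ∀ s : Finset (L.Formula α), ↑s ⊆ Γ → ∃ (N : Type u) (_ : L.Structure N) (_ : Nonempty N)
      (v : α → N), ∀ φ ∈ s, φ.Realize v) :
    ∃ (N : Type u) (_ : L.Structure N) (_ : Nonempty N) (v : α → N), ∀ φ ∈ Γ, φ.Realize v := by
  classical
  have hsat : Theory.IsSatisfiable (Formula.equivSentence '' Γ : L[[α]].Theory) := by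
    rw [Theory.isSatisfiable_iff_isFinitelySatisfiable]
    intro T₀ hT₀
    obtain ⟨N, _, _, v, hv⟩ := h (T₀.image Formula.equivSentence.symm) (by
      intro φ hφ
      obtain ⟨σ, hσ, rfl⟩ := Finset.mem_image.1 (Finset.mem_coe.1 hφ)
      obtain ⟨φ, hφ, rfl⟩ := hT₀ hσ
      rwa [Equiv.symm_apply_apply])
    let _ := constantsOn.structure v
    have : N ⊨ (T₀ : L[[α]].Theory) := by
      refine ⟨fun σ hσ => ?_⟩
      have h1 := hv _ (Finset.mem_image_of_mem _ hσ)
      exact (Formula.realize_equivSentence_symm N σ v).1 h1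
    exact Theory.Model.isSatisfiable N
  obtain ⟨M⟩ := hsat
  let _ : L.Structure M := (L.lhomWithConstants α).reduct M
  refine ⟨M, inferInstance, inferInstance, fun a => ((L.con a : L[[α]].Constants) : M),
    fun φ hφ => ?_⟩
  have h1 : M ⊨ Formula.equivSentence φ := M.is_model.realize_of_mem _ ⟨φ, hφ, rfl⟩
  exact (Formula.realize_equivSentence M φ).1 h1

end Compactness

section Mark

/-- The relation symbols of a language with one monadic predicate. -/
inductive MarkRelations : ℕ → Type u
  | mark : MarkRelations 1

/-- The language with one monadic predicate and no further symbols. -/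
def markLanguage : FirstOrder.Language.{u, u} := ⟨fun _ => PEmpty, MarkRelations⟩

instance : (markLanguage.{u}).IsRelational := fun _ => inferInstanceAs (IsEmpty PEmpty)

/-- The expansion of a language by a monadic predicate. -/
abbrev withMark (L : FirstOrder.Language.{u, u}) : FirstOrder.Language.{u, u} :=
  L.sum markLanguage

/-- The new predicate. -/
def markSymbol (L : FirstOrder.Language.{u, u}) : (withMark L).Relations 1 :=
  Sum.inr MarkRelations.mark

/-- The structure in which the predicate denotes a given set. -/
abbrev markStructure {C : Type u} (Q : Set C) : (markLanguage.{u}).Structure C where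
  funMap f := PEmpty.elim f
  RelMap r := match r with
    | .mark => fun x => x 0 ∈ Q

theorem theoryCard_withMark_le (L : FirstOrder.Language.{u, u}) :
    theoryCard (withMark L) ≤ theoryCard L := by
  refine max_le (le_max_left _ _) ?_
  rw [card_sum, Cardinal.lift_id, Cardinal.lift_id]
  refine Cardinal.add_le_of_le (le_max_left _ _) (le_max_right _ _) ?_
  have : Subsingleton markLanguage.{u}.Symbols := by
    refine ⟨?_⟩
    rintro (⟨i, f⟩ | ⟨i, r⟩) (⟨j, g⟩ | ⟨j, s⟩)
    · exact PEmpty.elim f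
    · exact PEmpty.elim f
    · exact PEmpty.elim g
    · change MarkRelations i at r
      change MarkRelations j at s
      cases r
      cases s
      rfl
  exact (Cardinal.lt_aleph0_of_finite _).le.trans (le_max_left _ _)

variable {L : FirstOrder.Language.{u, u}} {C : Type u} [L.Structure C]

theorem pPart_markSymbol (Q : Set C) :
    (letI := markStructure Q; PPart C (markSymbol L)) = Q := by
  ext x
  exact Iff.rfl

/-- Satisfaction in the expansion of `C` by a predicate for `Q`. -/
def RealizeMarked (Q : Set C) {α : Type*} (φ : (withMark L).Formula α) (v : α → C) : Prop :=
  letI := markStructure Q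
  φ.Realize v

/-- The limit pair is not obtained inside `C` and need not be good itself; it inherits every
first-order property common to the good pairs. -/
theorem exists_compact_pair [L.IsRelational] [Nonempty C] {μ : Cardinal.{u}} (hμ : ℵ₀ < μ)
    (hpow : μ ^< μ = μ) (hLμ : theoryCard L < μ) {n : ℕ} (good : Set C → (Fin n → C) → Prop)
    (X : Set ((withMark L).Formula (Fin n)))
    (h : ∀ s : Finset ((withMark L).Formula (Fin n)), ↑s ⊆ X →
      ∃ Q c, good Q c ∧ ∀ φ ∈ s, RealizeMarked Q φ c) :
    ∃ (N : Type u) (_ : (withMark L).Structure N) (_ : Nonempty N) (c' : Fin n → N),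
      (∀ φ : (withMark L).Formula (Fin n), (∀ Q c, good Q c → RealizeMarked Q φ c) →
        φ.Realize c') ∧ (∀ φ ∈ X, φ.Realize c') ∧ #N ≤ μ ∧
        IsCompactStructure (withMark L) μ N := by
  classical
  let Γ : Set ((withMark L).Formula (Fin n)) :=
    {φ | ∀ Q c, good Q c → RealizeMarked Q φ c} ∪ X
  obtain ⟨N₀, _, _, v, hv⟩ := exists_realization Γ (by
    intro s hs
    obtain ⟨Q, c, hgood, hc⟩ := h (s.filter (· ∈ X)) fun φ hφ =>
      (Finset.mem_filter.1 (Finset.mem_coe.1 hφ)).2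
    let _ := markStructure Q
    refine ⟨C, inferInstance, inferInstance, c, fun φ hφ => ?_⟩
    rcases hs hφ with h1 | h1
    · exact h1 Q c hgood
    · exact hc φ (Finset.mem_filter.2 ⟨hφ, h1⟩))
  have hcard := (theoryCard_withMark_le L).trans_lt hLμ
  obtain ⟨N, _, _, hN, hNμ, hcomp⟩ := exists_compactStructure (L := withMark L) hμ hpow
    ((le_max_right _ _).trans hcard.le) N₀
  obtain ⟨c', hc'⟩ := hcomp n ((fun φ : (withMark L).Formula (Fin n) => {v | φ.Realize v}) '' Γ)
    (Cardinal.mk_image_le.trans_lt ((Cardinal.mk_set_le _).trans_lt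
      (mk_formula_le_theoryCard.trans_lt hcard)))
    (by rintro _ ⟨φ, -, rfl⟩; exact definable_ofPred φ _)
    (by
      intro s hs
      have hs' : ∀ S ∈ s, ∃ φ ∈ Γ, {v : Fin n → N | φ.Realize v} = S := fun S hS => hs hS
      choose! f hf using hs'
      obtain ⟨w, hw⟩ := exists_realize_of_elementarilyEquivalent hN.symm (s.image f) v
        (by
          intro φ hφ
          obtain ⟨S, hS, rfl⟩ := Finset.mem_image.1 hφ
          exact hv _ (hf S hS).1)
      refine ⟨w, mem_sInter.2 fun S hS => ?_⟩
      rw [← (hf S hS).2]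
      exact hw _ (Finset.mem_image_of_mem f hS))
  exact ⟨N, inferInstance, inferInstance, c', fun φ hφ => mem_sInter.1 hc' _ ⟨φ, Or.inl hφ, rfl⟩,
    fun φ hφ => mem_sInter.1 hc' _ ⟨φ, Or.inr hφ, rfl⟩, hNμ, hcomp⟩

end Mark

/-! ### Saturated structures copied into the monster model -/

section Transfer

variable {L L' : FirstOrder.Language.{u, u}} {C N : Type u} [L.Structure C] [L.Structure N]

theorem elementarilyEquivalent_of_forall {M N : Type*} [L.Structure M] [L.Structure N]
    (h : ∀ σ : L.Sentence, M ⊨ σ → N ⊨ σ) : M ≅[L] N := by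
  refine elementarilyEquivalent_iff.2 fun σ => ⟨h σ, fun hσ => ?_⟩
  by_contra hn
  have h1 : N ⊨ σ.not := h _ ((Formula.realize_not).2 hn)
  exact (Formula.realize_not).1 h1 hσ

/-- The range of an elementary embedding. -/
noncomputable def elementaryRange (ι : N ↪ₑ[L] C) : L.ElementarySubstructure C where
  toSubstructure := ι.toEmbedding.toHom.range
  isElementary' := by
    intro n φ x
    let e := ι.toEmbedding.equivRange
    have h1 : x = e ∘ (e.symm ∘ x) := funext fun i => (e.apply_symm_apply (x i)).symm
    have h2 : ((↑) ∘ x : Fin n → C) = ι ∘ (e.symm ∘ x) := by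
      funext i
      rw [Function.comp_apply, Function.comp_apply]
      conv_lhs => rw [h1]
      exact Embedding.equivRange_apply _ _
    rw [h2, ι.map_formula]
    conv_rhs => rw [h1]
    exact (StrongHomClass.realize_formula e φ).symm

theorem coe_elementaryRange (ι : N ↪ₑ[L] C) : (elementaryRange ι : Set C) = range ι := by
  ext x
  exact Iff.rfl

theorem definable_preimage_elementaryEmbedding [L'.Structure N] (g : L →ᴸ L') [g.IsExpansionOn N]
    (ι : N ↪ₑ[L] C) {D : Set C} (hD : D ⊆ range ι) {k : ℕ} {S : Set (Fin k → C)}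
    (hS : D.Definable L S) : (univ : Set N).Definable L' {x : Fin k → N | ι ∘ x ∈ S} := by
  obtain ⟨m, φ, b, hb, rfl⟩ := definable_iff_fiber.1 hS
  choose b' hb' using fun i => hD (hb i)
  refine definable_iff_fiber.2 ⟨m, g.onFormula φ, b', fun _ => mem_univ _, ?_⟩
  ext x
  obtain rfl : ι ∘ b' = b := funext hb'
  simp only [mem_ofPred_eq, LHom.realize_onFormula, ← Sum.comp_elim, ι.map_formula]

/-- Because `Q` is definable in the larger language, membership in `Q` can be added to each
condition before compactness is applied. -/
theorem isCompactIn_image [L'.Structure N] (g : L →ᴸ L') [g.IsExpansionOn N] {μ : Cardinal.{u}}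
    (hμ : ℵ₀ < μ) (hcomp : IsCompactStructure L' μ N) (ι : N ↪ₑ[L] C) {Q : Set N}
    (hQ : ∀ k, (univ : Set N).Definable L' {x : Fin k → N | ∀ i, x i ∈ Q}) {D : Set C}
    (hD : D ⊆ range ι) : IsCompactIn L μ D (ι '' Q) := by
  classical
  intro k F hF hdef hfin
  let f : Set (Fin k → C) → Set (Fin k → N) := fun S => {x | ι ∘ x ∈ S} ∩ {x | ∀ i, x i ∈ Q}
  -- Inserting `univ` imposes membership in `Q` even when `F` is empty.
  obtain ⟨x, hx⟩ := hcomp k (f '' insert univ F)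
    (Cardinal.mk_image_le.trans_lt (Cardinal.mk_insert_le.trans_lt
      (Cardinal.add_lt_of_lt hμ.le hF (Cardinal.one_lt_aleph0.trans hμ))))
    (by
      rintro _ ⟨S, hS, rfl⟩
      refine (definable_preimage_elementaryEmbedding g ι hD ?_).inter (hQ k)
      rcases hS with rfl | hS
      exacts [definable_univ, hdef S hS])
    (by
      intro s hs
      have hs' : ∀ S ∈ s, ∃ S' ∈ insert univ F, f S' = S := fun S hS => hs hS
      choose! h hh using hs'
      obtain ⟨y, hy, hyQ⟩ := hfin ((s.image h).filter (· ∈ F)) (fun S hS =>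
        (Finset.mem_filter.1 (Finset.mem_coe.1 hS)).2)
      choose x hxQ hxy using hyQ
      refine ⟨x, mem_sInter.2 fun S hS => ?_⟩
      rw [← (hh S hS).2]
      refine ⟨?_, hxQ⟩
      have h1 : ι ∘ x = y := funext hxy
      rw [mem_ofPred_eq, h1]
      rcases (hh S hS).1 with h2 | h2
      · rw [h2]
        exact mem_univ _
      · exact mem_sInter.1 hy _ (Finset.mem_coe.2 (Finset.mem_filter.2
          ⟨Finset.mem_image_of_mem h hS, h2⟩)))
  refine ⟨ι ∘ x, mem_sInter.2 fun S hS => ?_, fun i => ⟨x i, ?_, rfl⟩⟩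
  · exact (mem_sInter.1 hx _ ⟨S, Or.inr hS, rfl⟩).1
  · exact (mem_sInter.1 hx _ ⟨univ, Or.inl rfl, rfl⟩).2 i

/-- A compact model of size at most `μ` is placed inside `C`; there the bound follows from stability
of that model. -/
theorem exists_rank_bound [L.IsRelational] [Nonempty C] {T : L.Theory} {κ μ : Cardinal.{u}}
    (hC : IsMonster κ T C) (hμ : ℵ₀ < μ) (hpow : μ ^< μ = μ) (hLμ : theoryCard L < μ) (hμκ : μ < κ)
    (P : L.Relations 1) (hstab : ∀ M : L.ElementarySubstructure C, #M < κ →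
      IsStableSet κ P (M : Set C)) {n m : ℕ} (ψ : L.Formula (Fin n ⊕ Fin m)) :
    ∃ (Δ : Finset (Task L n)) (k : ℕ), ¬HasRank P ψ Δ k (univ : Set (Fin n → C)) := by
  obtain ⟨N, _, _, hN, hNμ, hcomp⟩ := exists_compactStructure hμ hpow
    ((le_max_right _ _).trans hLμ.le) C
  obtain ⟨ι⟩ := hC.exists_elementaryEmbedding (hNμ.trans_lt hμκ) hN
  have hM : #(elementaryRange ι) ≤ μ := (Cardinal.mk_range_le (f := ι)).trans hNμ
  refine exists_not_hasRank hC hμ hpow hLμ hμκ P (elementaryRange ι) hM ?_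
    (hstab _ (hM.trans_lt hμκ)) ψ
  rw [coe_elementaryRange]
  have h1 := isCompactIn_image (LHom.id L) hμ hcomp ι (Q := univ)
    (fun k => by simp) subset_rfl
  rwa [image_univ] at h1

end Transfer

/-! ### Coding finitely many formulas into one -/

section Coding

variable {L : FirstOrder.Language.{u, u}} {C : Type u} [L.Structure C]

/-- Finitely many formulas can be coded into one by means of additional parameters. -/
theorem exists_code {m : ℕ} (s : Finset (Σ k : ℕ, L.Formula (Fin m ⊕ Fin k))) :
    ∃ (β : Type) (_ : Finite β) (Φ : L.Formula (Fin m ⊕ β)), ∀ B : Set C, B.Nontrivial →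
      ∀ p ∈ s, ∀ d : Fin p.1 → C, (∀ i, d i ∈ B) → ∃ d' : β → C, (∀ i, d' i ∈ B) ∧
        ∀ a : Fin m → C, p.2.Realize (Sum.elim a d) ↔ Φ.Realize (Sum.elim a d') := by
  classical
  induction s using Finset.induction_on with
  | empty => exact ⟨Empty, inferInstance, ⊥, by simp⟩
  | insert p s _ ih =>
    obtain ⟨β, _, Φ, hΦ⟩ := ih
    -- Whether two extra parameters are equal selects between the new formula and the code of the
    -- others; both cases must be available in `B`.
    let u : L.Term (Fin m ⊕ (Fin p.1 ⊕ (β ⊕ Bool))) := Term.var (Sum.inr (Sum.inr (Sum.inr true)))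
    let v : L.Term (Fin m ⊕ (Fin p.1 ⊕ (β ⊕ Bool))) := Term.var (Sum.inr (Sum.inr (Sum.inr false)))
    let Φ₁ : L.Formula (Fin m ⊕ (Fin p.1 ⊕ (β ⊕ Bool))) := p.2.relabel (Sum.map id Sum.inl)
    let Φ₂ : L.Formula (Fin m ⊕ (Fin p.1 ⊕ (β ⊕ Bool))) :=
      Φ.relabel (Sum.map id (Sum.inr ∘ Sum.inl))
    have key : ∀ (a : Fin m → C) (d : Fin p.1 → C) (d' : β → C) (w : Bool → C),
        ((u.equal v ⊓ Φ₁) ⊔ ((u.equal v).not ⊓ Φ₂) : L.Formula _).Realize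
          (Sum.elim a (Sum.elim d (Sum.elim d' w))) ↔
        (w true = w false ∧ p.2.Realize (Sum.elim a d)) ∨
          (w true ≠ w false ∧ Φ.Realize (Sum.elim a d')) := by
      intro a d d' w
      have h1 : (Sum.elim a (Sum.elim d (Sum.elim d' w)) ∘ Sum.map id Sum.inl :
          Fin m ⊕ Fin p.1 → C) = Sum.elim a d := by
        funext i; rcases i with i | i <;> rfl
      have h2 : (Sum.elim a (Sum.elim d (Sum.elim d' w)) ∘ Sum.map id (Sum.inr ∘ Sum.inl) :
          Fin m ⊕ β → C) = Sum.elim a d' := by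
        funext i; rcases i with i | i <;> rfl
      simp only [Formula.realize_sup, Formula.realize_inf, Formula.realize_not,
        Formula.realize_equal, Φ₁, Φ₂, Formula.realize_relabel, h1, h2, u, v, Term.realize_var,
        Sum.elim_inr, ne_eq]
    refine ⟨Fin p.1 ⊕ (β ⊕ Bool), inferInstance, (u.equal v ⊓ Φ₁) ⊔ ((u.equal v).not ⊓ Φ₂),
      fun B hB q hq d hd => ?_⟩
    obtain ⟨x, hx, y, hy, hxy⟩ := hB
    rcases Finset.mem_insert.1 hq with rfl | hq
    · refine ⟨Sum.elim d (Sum.elim (fun _ => x) fun _ => x), ?_, fun a => ?_⟩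
      · rintro (i | i | i)
        exacts [hd i, hx, hx]
      · rw [key]
        simp
    · obtain ⟨d', hd', h'⟩ := hΦ B ⟨x, hx, y, hy, hxy⟩ q hq d hd
      refine ⟨Sum.elim (fun _ => x) (Sum.elim d' fun i => bif i then x else y), ?_, fun a => ?_⟩
      · rintro (i | i | i)
        · exact hx
        · exact hd' i
        · cases i
          exacts [hy, hx]
      · rw [key, h']
        simp [hxy]

theorem SetEquiv.nontrivial [L.IsRelational] {A B : Set C} (h : SetEquiv L B A) (hA : 2 ≤ #A) :
    B.Nontrivial := by
  have h1 : (induced A : L.Substructure C) ⊨ Sentence.cardGe L 2 :=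
    (Sentence.realize_cardGe L 2).2 hA
  have h2 := (Sentence.realize_cardGe L 2).1 ((elementarilyEquivalent_iff.1 h _).2 h1)
  rw [← Set.nontrivial_coe_sort, ← Cardinal.one_lt_iff_nontrivial]
  exact lt_of_lt_of_le (by norm_num) h2

end Coding

/-! ### Uniformity and elimination of quantifiers -/

section

variable {L : FirstOrder.Language.{u, u}} [L.IsRelational] {C : Type u} [L.Structure C]

/-- Part of a relational structure `N` that is embedded into `C` corresponds to an induced
substructure of `C`. -/
theorem exists_embedding_of_image {N : Type u} [L.Structure N] (ι : N ↪[L] C) (Q : Set N) :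
    ∃ f : (induced (ι '' Q) : L.Substructure C) ↪[L] N, range f = Q := by
  have h : ∀ b : (induced (ι '' Q) : L.Substructure C), ∃ x ∈ Q, ι x = b := fun b => b.2
  choose f hfQ hf using h
  refine ⟨⟨⟨f, fun b b' hbb => Subtype.ext ?_⟩, fun {k} F => isEmptyElim F, fun {k} R x => ?_⟩, ?_⟩
  · rw [← hf b, ← hf b', hbb]
  · rw [← ι.map_rel]
    refine iff_of_eq (congrArg _ ?_)
    funext i
    exact hf (x i)
  · refine Subset.antisymm (range_subset_iff.2 hfQ) fun x hx => ⟨⟨ι x, x, hx, rfl⟩, ?_⟩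
    exact ι.injective (hf _)

theorem realizeMarked_relativize (Q : Set C) (σ : L.Sentence) (n : ℕ) (c : Fin n → C) :
    RealizeMarked Q (Formula.relabel (Empty.elim : Empty → Fin n)
      (relativize LHom.sumInl (markSymbol L) σ : (withMark L).Formula Empty)) c ↔
      (induced Q : L.Substructure C) ⊨ σ := by
  let _ := markStructure Q
  unfold RealizeMarked
  rw [Formula.realize_relabel, Sentence.Realize, Formula.Realize, Formula.Realize,
    ← realize_relativize (LHom.sumInl : L →ᴸ withMark L) (markSymbol L)
      (induced Q : L.Substructure C).subtype
      ((Subtype.range_coe (s := Q)).trans (pPart_markSymbol Q).symm)]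
  exact iff_of_eq (congrArg₂ _ (Subsingleton.elim _ _) (Subsingleton.elim _ _))

variable [Nonempty C] {T : L.Theory} {κ : Cardinal.{u}}

/-- The types in `S_*(B)`, for all `B ≡ A`, are uniformly definable. -/
theorem exists_uniform_definition (P : L.Relations 1)
    (hκ : ∃ μ : Cardinal.{u}, theoryCard L < μ ∧ μ < κ ∧ μ ^< μ = μ) (hC : IsMonster κ T C)
    (hstab : ∀ M : L.ElementarySubstructure C, #M < κ → IsStableSet κ P (M : Set C))
    (A : Set C) (hA : IsStableSet κ P A) (hA₂ : 2 ≤ #A) {n m : ℕ}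
    (ψ : L.Formula (Fin n ⊕ Fin m)) :
    ∃ (k : ℕ) (Φ : L.Formula (Fin m ⊕ Fin k)), ∀ B : Set C, #B < κ → SetEquiv L B A →
      ∀ c : Fin n → C, IsStarComplete P (B ∪ range c) B → ∃ d : Fin k → C, (∀ i, d i ∈ B) ∧
        ∀ a : Fin m → C, (∀ i, a i ∈ B) →
          (ψ.Realize (Sum.elim c a) ↔ Φ.Realize (Sum.elim a d)) := by
  classical
  obtain ⟨μ, hLμ, hμκ, hpow⟩ := hκ
  have hμ : ℵ₀ < μ := (le_max_left _ _).trans_lt hLμ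
  by_contra hno
  push Not at hno
  let g : L →ᴸ withMark L := LHom.sumInl
  let good : Set C → (Fin n → C) → Prop := fun Q c =>
    SetEquiv L Q A ∧ IsStarComplete P (Q ∪ range c) Q
  obtain ⟨N, _, _, c', hgood, hdiff, hNμ, hcomp⟩ := exists_compact_pair hμ hpow hLμ good
    (range fun p : Σ k : ℕ, L.Formula (Fin m ⊕ Fin k) => differFormula g (markSymbol L) ψ p.2) (by
      intro s hs
      have hs' : ∀ φ ∈ s, ∃ p : Σ k : ℕ, L.Formula (Fin m ⊕ Fin k),
          differFormula g (markSymbol L) ψ p.2 = φ := fun φ hφ => hs hφ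
      have : Nonempty (Σ k : ℕ, L.Formula (Fin m ⊕ Fin k)) := ⟨⟨0, ⊥⟩⟩
      choose! f hf using hs'
      -- A pair that defeats the code of finitely many formulas defeats each of them.
      obtain ⟨β, _, Φ, hΦ⟩ := exists_code (C := C) (s.image f)
      let e := Finite.equivFin β
      obtain ⟨Q, hQκ, hQA, c, hc, hQ⟩ := hno _ (Φ.relabel (Sum.map id e))
      refine ⟨Q, c, ⟨hQA, hc⟩, fun φ hφ => ?_⟩
      rw [← hf φ hφ]
      let _ := markStructure Q
      unfold RealizeMarked
      rw [realize_differFormula, pPart_markSymbol]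
      intro d hd
      obtain ⟨d', hd', hdd⟩ := hΦ Q (hQA.nontrivial hA₂) _ (Finset.mem_image_of_mem f hφ) d hd
      obtain ⟨a, ha, ha'⟩ := hQ (d' ∘ e.symm) fun i => hd' _
      refine ⟨a, ha, ?_⟩
      rw [hdd]
      have h1 : (Sum.elim a (d' ∘ e.symm) ∘ Sum.map id e : Fin m ⊕ β → C) = Sum.elim a d' := by
        funext i
        rcases i with i | i
        · rfl
        · simp
      rw [Formula.realize_relabel, h1] at ha'
      tauto)
  let _ : L.Structure N := g.reduct N
  let Q : Set N := PPart N (markSymbol L)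
  have hNC : N ≅[L] C := by
    refine (elementarilyEquivalent_of_forall fun σ hσ => ?_).symm
    have h1 := hgood (Formula.relabel (Empty.elim : Empty → Fin n) (g.onFormula σ)) (by
      intro Q c _
      let _ := markStructure Q
      unfold RealizeMarked
      rw [Formula.realize_relabel, LHom.realize_onFormula, Subsingleton.elim (c ∘ _) default]
      exact hσ)
    rw [Formula.realize_relabel, LHom.realize_onFormula, Subsingleton.elim (c' ∘ _) default] at h1
    exact h1
  obtain ⟨ι⟩ := hC.exists_elementaryEmbedding (hNμ.trans_lt hμκ) hNC
  let B : Set C := ι '' Q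
  let c : Fin n → C := ι ∘ c'
  have hBμ : #B ≤ μ := Cardinal.mk_image_le.trans ((Cardinal.mk_set_le _).trans hNμ)
  have hBA : SetEquiv L B A := by
    refine (elementarilyEquivalent_of_forall fun σ hσ => ?_).symm
    have h1 := hgood _ fun Q c hQ => (realizeMarked_relativize Q σ n c).2
      ((elementarilyEquivalent_iff.1 hQ.1 σ).2 hσ)
    obtain ⟨f, hf⟩ := exists_embedding_of_image ι.toEmbedding Q
    rw [Formula.realize_relabel] at h1
    have h2 := realize_relativize g (markSymbol L) f hf σ default default
    refine h2.1 ?_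
    rw [Subsingleton.elim (f ∘ default) (c' ∘ Empty.elim),
      Subsingleton.elim (f ∘ default) (default : Fin 0 → N)]
    exact h1
  have hstar : IsStarComplete P (B ∪ range c) B := by
    refine isStarComplete_of_witnesses fun j Y hY ⟨z, hzP, hz⟩ => ?_
    obtain ⟨k, φ, b, hb, rfl⟩ := definable_iff_fiber.1 hY
    choose b' hb'Q hb' using hb
    obtain rfl : ι ∘ b' = b := funext hb'
    let φ' : L.Formula ((Fin n ⊕ Fin k) ⊕ Fin j) := φ.relabel
      (Sum.elim (Sum.elim (fun i => Sum.inl (Sum.inl i)) Sum.inr) fun i => Sum.inl (Sum.inr i))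
    have hφ' : ∀ {M : Type u} [L.Structure M] (c : Fin n → M) (y : Fin k → M) (z : Fin j → M),
        φ'.Realize (Sum.elim (Sum.elim c y) z) ↔ φ.Realize (Sum.elim (Sum.elim c z) y) := by
      intro M _ c y z
      rw [Formula.realize_relabel]
      refine iff_of_eq (congrArg _ ?_)
      funext i
      rcases i with (i | i) | i <;> rfl
    -- Completeness of `B ∪ c` with witnesses in `B` is a scheme of first-order properties of the
    -- pair, so it passes to the limit.
    have h1 := hgood (witnessFormula g P (markSymbol L) φ') (by
      rintro Q c ⟨-, hQ⟩
      let _ := markStructure Q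
      unfold RealizeMarked
      rw [realize_witnessFormula, pPart_markSymbol]
      rintro y hy ⟨z, hz, hzP⟩
      obtain ⟨z', hz', hz'Q⟩ := hQ j {z | φ'.Realize (Sum.elim (Sum.elim c y) z)}
        (definable_fiber_left (definable_ofPred φ' _) _ (by
          rintro (i | i)
          exacts [Or.inr (mem_range_self i), Or.inl (hy i)])) ⟨z, hz, hzP⟩
      exact ⟨z', ⟨hz', fun i => (hz'Q i).1⟩, fun i => (hz'Q i).2⟩)
    rw [realize_witnessFormula] at h1
    have hP : ∀ x : N, ι x ∈ PPart C P ↔ x ∈ PPart N P := by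
      intro x
      have := ι.map_rel P ![x]
      rwa [show ι ∘ ![x] = ![ι x] by funext i; simp] at this
    have hex : ∃ z : Fin j → N, φ'.Realize (Sum.elim (Sum.elim c' b') z) ∧
        ∀ i, z i ∈ PPart N P := by
      have h2 := ι.map_formula ((φ' ⊓ tupleIn P Sum.inr).iExs (Fin j)) (Sum.elim c' b')
      simp only [Formula.realize_iExs, Formula.realize_inf, realize_tupleIn, Sum.elim_inr] at h2
      refine h2.1 ⟨z, ?_, hzP⟩
      rw [Sum.comp_elim, hφ']
      exact hz
    obtain ⟨z', ⟨hz', hz'P⟩, hz'Q⟩ := h1 b' hb'Q hex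
    refine ⟨ι ∘ z', fun i => ⟨(hP _).2 (hz'P i), z' i, hz'Q i, rfl⟩, ?_⟩
    rw [hφ', ← ι.map_formula, Sum.comp_elim, Sum.comp_elim] at hz'
    exact hz'
  have hcompB : IsCompactIn L μ (B ∪ range c) B := by
    refine isCompactIn_image g hμ hcomp ι (fun k => ?_) ?_
    · exact definable_pPart (markSymbol L) univ k id
    · exact union_subset (image_subset_range _ _) (range_subset_iff.2 fun i => mem_range_self _)
  -- Stability of `A` enters here, as the bound on types over `B ≡ A`.
  have hbase : IsStableBase T κ μ P B := ⟨hC, hμ, hpow, hLμ, hμκ, hBμ,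
    hA.2 B (hBμ.trans_lt hμκ) hBA, hcompB.mono subset_union_left, hstar.mono subset_union_left⟩
  obtain ⟨Δ, j, hΔ⟩ := exists_rank_bound hC hμ hpow hLμ hμκ P hstab ψ
  obtain ⟨k, Φ, d, hd, hΦ⟩ := hbase.exists_definition ψ hcompB hstar Δ j 0 Fin.elim0 univ
    definable_univ (isIsolatedOver_elim0 B _) (mem_univ _) (by simpa using hΔ)
  choose d' hd'Q hd' using hd
  obtain rfl : ι ∘ d' = d := funext hd'
  -- The definition found for `c` is one of the formulas that the pair was built to defeat.
  have h1 := (realize_differFormula g (markSymbol L) ψ Φ c').1 (hdiff _ ⟨⟨k, Φ⟩, rfl⟩) d' hd'Q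
  obtain ⟨a, ha, hne⟩ := h1
  refine hne ?_
  have h2 := hΦ (ι ∘ a) fun i => ⟨a i, ha i, rfl⟩
  rwa [← Sum.comp_elim, ← Sum.comp_elim, ι.map_formula, ι.map_formula] at h2

/-- Every formula is equivalent to a quantifier-free formula with one more variable. -/
theorem exists_isQF (hQE : EliminatesToPredicates T) (hC : C ⊨ T) {m k : ℕ}
    (Φ : L.Formula (Fin m ⊕ Fin k)) : ∃ Ψ : L.Formula (Fin m ⊕ Fin (k + 1)), Ψ.IsQF ∧
      ∀ (B : Set C) (a : Fin m → (induced B : L.Substructure C))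
        (d : Fin (k + 1) → (induced B : L.Substructure C)),
        Ψ.Realize (Sum.elim a d) ↔
          Φ.Realize (Sum.elim (fun i => (a i : C)) fun i => (d (Fin.castSucc i) : C)) := by
  -- A dummy parameter makes the arity positive, as elimination requires. A predicate has the same
  -- meaning in `C` and in the induced structure.
  let e : Fin m ⊕ Fin (k + 1) ≃ Fin (m + k + 1) := finSumFinEquiv
  obtain ⟨R, hR⟩ := hQE (m + k) (Φ.relabel (e ∘ Sum.map id Fin.castSucc))
  refine ⟨R.formula fun i => Term.var (e.symm i), ?_, fun B a d => ?_⟩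
  · exact BoundedFormula.IsQF.of_isAtomic (BoundedFormula.IsAtomic.rel _ _)
  · have h1 := hR.realize_iff (M := C) (v := fun i => ((Sum.elim a d (e.symm i) :
      (induced B : L.Substructure C)) : C))
    have h2 : ((fun i => ((Sum.elim a d (e.symm i) : (induced B : L.Substructure C)) : C)) ∘
        (e ∘ Sum.map id Fin.castSucc) : Fin m ⊕ Fin k → C) =
        Sum.elim (fun i => (a i : C)) fun i => (d (Fin.castSucc i) : C) := by
      funext i
      simp only [Function.comp_apply, Equiv.symm_apply_apply]
      rcases i with i | i <;> rfl
    rw [Formula.realize_relabel, h2] at h1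
    rw [h1, Formula.realize_rel, Formula.realize_rel]
    exact Iff.rfl

end

end StableOverP

theorem theorem4p1 {L : FirstOrder.Language.{u, u}} [L.IsRelational]
    (T : L.Theory) (P : L.Relations 1) (C : Type u) [L.Structure C] [Nonempty C]
    (κ : Cardinal.{u})
    -- the monster model is large: `|T| < μ < κ` for some `μ` with `μ ^ (< μ) = μ`
    (hκ : ∃ μ : Cardinal.{u}, StableOverP.theoryCard L < μ ∧ μ < κ ∧ μ ^< μ = μ)
    (hT : T.IsComplete)
    (hQE : StableOverP.EliminatesToPredicates T)
    (hC : StableOverP.IsMonster κ T C)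
    (hP₁ : StableOverP.DefinableInP C P)
    (hP₂ : StableOverP.TypesOverPDefinable C P)
    -- every (small) model is stable
    (hstab : ∀ M : L.ElementarySubstructure C, Cardinal.mk M < κ →
      StableOverP.IsStableSet κ P (M : Set C))
    (A : Set C) (hAκ : Cardinal.mk A < κ) (hA : StableOverP.IsStableSet κ P A)
    (hA₂ : 2 ≤ Cardinal.mk A)
    (n m : ℕ) (ψ : L.Formula (Fin n ⊕ Fin m)) :
    ∃ (k : ℕ) (Ψ : L.Formula (Fin m ⊕ Fin k)), Ψ.IsQF ∧
      ∀ B : Set C, Cardinal.mk B < κ → StableOverP.SetEquiv L B A →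
        ∀ p ∈ StableOverP.StarTypes P B n,
          ∃ d : Fin k → (StableOverP.induced B : L.Substructure C),
            StableOverP.DefinesRestriction p ψ Ψ d := by
  obtain ⟨k, Φ, hΦ⟩ := StableOverP.exists_uniform_definition P hκ hC hstab A hA hA₂ ψ
  obtain ⟨Ψ, hΨ, hiff⟩ := StableOverP.exists_isQF hQE hC.models Φ
  refine ⟨k + 1, Ψ, hΨ, fun B hB hBA p hp => ?_⟩
  obtain ⟨c, rfl, hc⟩ := StableOverP.mem_starTypes_iff.1 hp
  obtain ⟨d, hd, hdef⟩ := hΦ B hB hBA c hc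
  obtain ⟨x, hx⟩ := (hBA.nontrivial hA₂).nonempty
  -- The dummy parameter can be any element `x` of `B`.
  refine ⟨Fin.snoc (fun i => ⟨d i, hd i⟩) ⟨x, hx⟩, fun a => ?_⟩
  refine (StableOverP.memType_tp (A := B) ψ a c).trans ?_
  rw [hiff, hdef _ fun i => (a i).2]
  simp only [Fin.snoc_castSucc]
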